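/- Let $\Omega\subset\mathbb R^N$ be a bounded domain (nonempty, open, connected) with boundary of class $C^2$ and exterior unit normal $\nu$. Let $u\in C^1(\overline\Omega)\cap C^2(\Omega)$ satisfy $$-\Delta u=1\ \text{ in }\Omega,\qquad u=0\ \text{ on }\partial\Omega,\qquad u_\nu=c\ \text{ on }\partial\Omega$$ for some constant $c\in\mathbb R$. (Here $C^k(\overline\Omega)$ is the space of functions continuous on $\overline\Omega$ and $C^k$ in $\Omega$ all of whose derivatives of order at most $k$ extend continuously from $\Omega$ to $\overline\Omega$.) For $t>0$ let $\Gamma_t=\{x\in\Omega:\ \mathrm{dist}(x,\partial\Omega)=t\}$. For a set $\Gamma\subset\mathbb R^N$ and $u:\Gamma\to\mathbb R$ put $$\operatorname*{osc}_{\Gamma}u=\max_\Gamma u-\min_\Gamma u,\qquad [u]_\Gamma=\sup_{\substack{z,w\in\Gamma\\ z\ne w}}\frac{|u(z)-u(w)|}{|z-w|},\qquad |u|_\Gamma=\sup_{\substack{z,w\in\Gamma\\ z\ne w}}\frac{|u(z)-u(w)|}{d_\Gamma(z,w)},$$ where $d_\Gamma(z,w)\in[0,\infty]$ is the infimum of the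 lengths of the continuous curves in $\Gamma$ joining $z$ and $w$ (a quotient with $d_\Gamma(z,w)=\infty$ being $0$). Then, for all sufficiently small $t>0$, $u$ attains a maximum and a minimum on $\Gamma_t\neq\emptyset$, and $$\operatorname*{osc}_{\Gamma_t}u=o(t)\quad\text{as } t\to0^+ .$$ If, in addition, $u\in C^2(\overline\Omega)$, then $[u]_{\Gamma_t}$ and $|u|_{\Gamma_t}$ are finite for all sufficiently small $t>0$, and $$[u]_{\Gamma_t}=o(t)\quad\text{and}\quad |u|_{\Gamma_t}=o(t)\quad\text{as } t\to0^+ .$$ The last assertion also holds in arc-length form: for every $\varepsilon>0$ there is $\delta>0$ such that, for every $0<t<\delta$ and every $C^1$-regular simple closed curve $\Gamma\subset\Gamma_t$ of length $L$ with arc-length parametrization $z(s)$, $s\in[0,L]$ (extended periodically), $$\sup_{\substack{0\le s,s'\le L\\ s\ne s'}}\frac{|u(z(s))-u(z(s'))|}{\min(|s-s'|,\,L-|s-s'|)}\le\varepsilon t ,$$ where the quotient for $\{s,s'\}=\{0,L\}$, in which numerator and denominator both vanish, is read as $0$. -/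

import Mathlib

open Set Filter Topology Asymptotics
open scoped ENNReal

noncomputable section

/-- `ρ` is a `C²` defining function of `Ω` in the open neighbourhood `U` of the point `p`:
its gradient vanishes nowhere in `U`, and inside `U` the set `Ω` is `{ρ < 0}`. -/
structure IsLocalDefiningFunction {N : ℕ} (Ω : Set (EuclideanSpace ℝ (Fin N)))
    (p : EuclideanSpace ℝ (Fin N)) (U : Set (EuclideanSpace ℝ (Fin N)))
    (ρ : EuclideanSpace ℝ (Fin N) → ℝ) : Prop where
  isOpen : IsOpen U
  mem : p ∈ U
  contDiffOn : ContDiffOn ℝ 2 ρ U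
  gradient_ne_zero : ∀ x ∈ U, gradient ρ x ≠ 0
  inter_eq : Ω ∩ U = {x ∈ U | ρ x < 0}

/-- The boundary of `Ω` is of class `C²`. -/
def HasC2Boundary {N : ℕ} (Ω : Set (EuclideanSpace ℝ (Fin N))) : Prop :=
  ∀ p ∈ frontier Ω, ∃ U ρ, IsLocalDefiningFunction Ω p U ρ

/-- `ν` is the exterior unit normal to `∂Ω` at the boundary point `p`. -/
def IsOuterUnitNormal {N : ℕ} (Ω : Set (EuclideanSpace ℝ (Fin N)))
    (p ν : EuclideanSpace ℝ (Fin N)) : Prop :=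
  p ∈ frontier Ω ∧ ∃ U ρ, IsLocalDefiningFunction Ω p U ρ ∧ ν = ‖gradient ρ p‖⁻¹ • gradient ρ p

/-- The space `Cᵏ(Ω̄)`: `u` is continuous on `Ω̄`, of class `Cᵏ` in the open set `Ω`, and all its
derivatives of order at most `k` extend continuously from `Ω` to `Ω̄`. -/
def IsCkUpToBoundary {N : ℕ} (k : ℕ) (Ω : Set (EuclideanSpace ℝ (Fin N)))
    (u : EuclideanSpace ℝ (Fin N) → ℝ) : Prop :=
  ContinuousOn u (closure Ω) ∧ ContDiffOn ℝ k u Ω ∧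
    ∀ m ≤ k, ∃ G : EuclideanSpace ℝ (Fin N) →
        ContinuousMultilinearMap ℝ (fun _ : Fin m => EuclideanSpace ℝ (Fin N)) ℝ,
      ContinuousOn G (closure Ω) ∧ EqOn (iteratedFDeriv ℝ m u) G Ω

/-- The (one-sided) derivative of `u` at the boundary point `p` in the direction of the exterior
normal `ν` exists, taken along the points `p + s ν` with `s ≤ 0`, and it equals `c`. -/
def HasNormalDerivAt {N : ℕ} (u : EuclideanSpace ℝ (Fin N) → ℝ)
    (p ν : EuclideanSpace ℝ (Fin N)) (c : ℝ) : Prop :=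
  HasDerivWithinAt (fun s : ℝ => u (p + s • ν)) c (Iic 0) 0

/-- `u` solves the torsion problem `-Δu = 1` in `Ω`, `u = 0` on `∂Ω`. -/
def SolvesTorsionProblem {N : ℕ} (Ω : Set (EuclideanSpace ℝ (Fin N)))
    (u : EuclideanSpace ℝ (Fin N) → ℝ) : Prop :=
  (∀ x ∈ Ω, -(Laplacian.laplacian u x) = 1) ∧ ∀ x ∈ frontier Ω, u x = 0

/-- The parallel surface `Γ_t = {x ∈ Ω : dist(x, ∂Ω) = t}`. -/
def parallelSurface {N : ℕ} (Ω : Set (EuclideanSpace ℝ (Fin N))) (t : ℝ) :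
    Set (EuclideanSpace ℝ (Fin N)) :=
  {x ∈ Ω | Metric.infDist x (frontier Ω) = t}

/-- The oscillation `max_Γ u - min_Γ u`. -/
def oscOn {N : ℕ} (u : EuclideanSpace ℝ (Fin N) → ℝ) (Γ : Set (EuclideanSpace ℝ (Fin N))) : ℝ :=
  sSup (u '' Γ) - sInf (u '' Γ)

/-- The seminorm `[u]_Γ = sup |u(z) - u(w)| / |z - w|` over distinct points `z, w` of `Γ`. -/
def chordSeminorm {N : ℕ} (u : EuclideanSpace ℝ (Fin N) → ℝ)
    (Γ : Set (EuclideanSpace ℝ (Fin N))) : ℝ≥0∞ :=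
  ⨆ (z ∈ Γ) (w ∈ Γ) (_ : z ≠ w), ENNReal.ofReal |u z - u w| / edist z w

/-- The intrinsic distance in `Γ`: the infimum of the lengths of the continuous curves in `Γ` that
join `z` and `w` (it is `∞` if there is no such curve of finite length). -/
def intrinsicEDist {N : ℕ} (Γ : Set (EuclideanSpace ℝ (Fin N)))
    (z w : EuclideanSpace ℝ (Fin N)) : ℝ≥0∞ :=
  ⨅ (γ : ℝ → EuclideanSpace ℝ (Fin N)) (_ : ContinuousOn γ (Icc 0 1))
    (_ : MapsTo γ (Icc 0 1) Γ) (_ : γ 0 = z) (_ : γ 1 = w), eVariationOn γ (Icc 0 1)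

/-- The seminorm `|u|_Γ`, the supremum of `|u(z) - u(w)|` over the intrinsic distance of
distinct points `z, w` of `Γ`. -/
def intrinsicSeminorm {N : ℕ} (u : EuclideanSpace ℝ (Fin N) → ℝ)
    (Γ : Set (EuclideanSpace ℝ (Fin N))) : ℝ≥0∞ :=
  ⨆ (z ∈ Γ) (w ∈ Γ) (_ : z ≠ w), ENNReal.ofReal |u z - u w| / intrinsicEDist Γ z w

/-- `z` is a parametrization by arc length, extended `L`-periodically, of the `C¹`-regular simple
closed curve `Γ` of length `L`. -/
structure IsClosedArcLengthParam {N : ℕ} (Γ : Set (EuclideanSpace ℝ (Fin N))) (L : ℝ)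
    (z : ℝ → EuclideanSpace ℝ (Fin N)) : Prop where
  length_pos : 0 < L
  contDiff : ContDiff ℝ 1 z
  periodic : Function.Periodic z L
  norm_deriv : ∀ s, ‖deriv z s‖ = 1
  injOn : InjOn z (Ico 0 L)
  image_eq : z '' Ico 0 L = Γ

/-- The seminorm `|u|_Γ` of a closed curve `Γ` of length `L`, written through its arc-length
parametrization `z`: the supremum of `|u(z(s)) - u(z(s'))| / min(|s - s'|, L - |s - s'|)`.
The pair `{s, s'} = {0, L}`, where `z(s) = z(s')`, contributes `0 / 0 = 0`. -/
def arcSeminorm {N : ℕ} (u : EuclideanSpace ℝ (Fin N) → ℝ) (L : ℝ)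
    (z : ℝ → EuclideanSpace ℝ (Fin N)) : ℝ≥0∞ :=
  ⨆ (s ∈ Icc (0 : ℝ) L) (s' ∈ Icc (0 : ℝ) L) (_ : s ≠ s'),
    ENNReal.ofReal |u (z s) - u (z s')| / ENNReal.ofReal (min |s - s'| (L - |s - s'|))

end

/-!
Write `d` for the distance to `∂Ω`, `n` for the exterior unit normal, and let `x ∈ Ω` be near the
boundary with nearest boundary point `p`, so that `x = p - d(x) n(p)`.

The mean value theorem on the segment from `x` to `p`, where the normal derivative is close to its
boundary value `c`, gives `u = -c d + o(d)` uniformly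
(`IsNormalField.abs_add_mul_infDist_le`). On `Γ_t` this reads `u = -c t + o(t)`, which is the
bound of the oscillation.

If `u ∈ C²(Ω̄)`, one more order gives `u = -c d + H d²`, where `H` is bounded and uniformly
continuous near the boundary, since `2 H(x)` is close to the second normal derivative at `p`
(`IsCauchyData.exists_abs_quotient_sub_le`). Hence `u(z) - u(w) = t² (H(z) - H(w))` for
`z, w ∈ Γ_t`, which is at most `ε t |z - w|` as soon as `|z - w| ≥ κ t` for a fixed `κ > 0`: there
`|H(z) - H(w)|` is small if `z` and `w` are close, and bounded otherwise.

For `|z - w| < κ t` Taylor's formula at `z` reduces the claim to a bound of the gradient of `u`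
at `z`. Its tangential part is `o(t)` (`IsCauchyData.exists_abs_deriv_tangent_le`): after replacing
`u` by `-u` if necessary, `c ≤ 0`, and at the points `z + σ t v` with `v` a tangential unit vector
the expansion bounds `u` from below, because `∂Ω` has interior touching balls of a uniform radius
and so `d` drops only by `O(σ² t²)`; a linear function that is bounded from below by
`-o(t²) - O(σ² t²)` on the tangential disc of radius `σ t` has slope `o(t)`. Its normal part is
`c + O(t)`, and the interior ball at `p` bounds the normal component of `w - z` on one side by
`|w - z|² / R`. As `c ≤ 0` this bounds `u(w) - u(z)` from above, and exchanging `z` and `w` gives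
the other bound (`IsCauchyData.exists_abs_sub_le`). Only the interior balls and the continuity of
the normal enter, and no smoothness of `d` or of `Γ_t`.

The intrinsic distance and the arc length dominate the Euclidean distance, so the three seminorms
are all controlled by the Lipschitz constant of `u` on `Γ_t`.
-/

/-! ### Outer normals and interior balls -/

section HalfSpace

variable {E : Type*} [NormedAddCommGroup E] [InnerProductSpace ℝ E]

/-- If the open half-space `⟪a, ·⟫ < 0` lies in the half-space `⟪b, ·⟫ ≤ 0`, then the two have the
same outer unit normal. -/
theorem normalize_eq_of_halfSpace_subset {a b : E} (ha : ‖a‖ = 1) (hb : b ≠ 0)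
    (h : ∀ v, inner ℝ a v < 0 → inner ℝ b v ≤ 0) : ‖b‖⁻¹ • b = a := by
  have haa : inner ℝ a a = 1 := by rw [real_inner_self_eq_norm_sq, ha]; norm_num
  set k := inner ℝ b a with hk
  have hka : inner ℝ a b = k := real_inner_comm _ _
  have hk0 : 0 ≤ k := by
    have := h (-a) (by rw [inner_neg_right, haa]; norm_num)
    rw [inner_neg_right] at this
    linarith
  -- Test with the tangential part of `b`, tilted slightly into the half-space.
  have hw : ∀ δ : ℝ, 0 < δ → ‖b - k • a‖ ^ 2 ≤ 0 + δ * k := by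
    intro δ hδ
    have h1 : inner ℝ a ((b - k • a) - δ • a) = -δ := by
      rw [inner_sub_right, inner_sub_right, inner_smul_right, inner_smul_right, haa, hka]; ring
    have h2 := h _ (by rw [h1]; linarith)
    have h3 : inner ℝ b ((b - k • a) - δ • a) = ‖b - k • a‖ ^ 2 - δ * k := by
      rw [← real_inner_self_eq_norm_sq]
      simp only [inner_sub_right, inner_sub_left, inner_smul_right, inner_smul_left, haa, hka,
        ← hk, RCLike.conj_to_real]
      ring
    linarith
  have hz : ‖b - k • a‖ ^ 2 ≤ 0 := by
    have ht : Tendsto (fun δ : ℝ => 0 + δ * k) (𝓝[>] 0) (𝓝 (0 + 0 * k)) :=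
      ((continuous_const.add (continuous_id.mul continuous_const)).tendsto 0).mono_left
        nhdsWithin_le_nhds
    have := ge_of_tendsto ht (by filter_upwards [self_mem_nhdsWithin] with δ hδ using hw δ hδ)
    simpa using this
  have hba : b = k • a := by
    have : ‖b - k • a‖ = 0 := by nlinarith [norm_nonneg (b - k • a)]
    exact sub_eq_zero.mp (norm_eq_zero.mp this)
  have hk1 : k ≠ 0 := by
    rintro h0
    exact hb (by rw [hba, h0, zero_smul])
  have hnb : ‖b‖ = k := by
    rw [hba, norm_smul, ha, mul_one, Real.norm_of_nonneg hk0]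
  calc ‖b‖⁻¹ • b = k⁻¹ • k • a := by rw [hnb, ← hba]
    _ = a := by rw [smul_smul, inv_mul_cancel₀ hk1, one_smul]

end HalfSpace

section Boundary

variable {N : ℕ} {Ω : Set (EuclideanSpace ℝ (Fin N))}

namespace IsLocalDefiningFunction

variable {p q : EuclideanSpace ℝ (Fin N)} {U : Set (EuclideanSpace ℝ (Fin N))}
  {ρ : EuclideanSpace ℝ (Fin N) → ℝ}

theorem mem_iff (h : IsLocalDefiningFunction Ω p U ρ) (hq : q ∈ U) : q ∈ Ω ↔ ρ q < 0 := by
  have := Set.ext_iff.mp h.inter_eq q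
  simpa [hq] using this

theorem differentiableAt (h : IsLocalDefiningFunction Ω p U ρ) (hq : q ∈ U) :
    DifferentiableAt ℝ ρ q :=
  (h.contDiffOn.differentiableOn (by norm_num)).differentiableAt (h.isOpen.mem_nhds hq)

theorem continuousAt_gradient (h : IsLocalDefiningFunction Ω p U ρ) (hq : q ∈ U) :
    ContinuousAt (gradient ρ) q := by
  have h1 : ContinuousAt (fderiv ℝ ρ) q :=
    (h.contDiffOn.continuousOn_fderiv_of_isOpen h.isOpen (by norm_num)).continuousAt
      (h.isOpen.mem_nhds hq)
  exact ((InnerProductSpace.toDual ℝ _).symm.continuous.continuousAt).comp h1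

theorem eq_zero (h : IsLocalDefiningFunction Ω p U ρ) (hΩ : IsOpen Ω) (hq : q ∈ U)
    (hqf : q ∈ frontier Ω) : ρ q = 0 := by
  apply le_antisymm
  · have hcl : q ∈ closure (Ω ∩ U) := by
      rw [mem_closure_iff_nhds]
      intro t ht
      obtain ⟨y, hy1, hy2⟩ := mem_closure_iff_nhds.mp (frontier_subset_closure hqf) (t ∩ U)
        (inter_mem ht (h.isOpen.mem_nhds hq))
      exact ⟨y, hy1.1, hy2, hy1.2⟩
    have hc : ContinuousWithinAt ρ (Ω ∩ U) q :=
      (h.differentiableAt hq).continuousAt.continuousWithinAt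
    have : NeBot (𝓝[Ω ∩ U] q) := mem_closure_iff_nhdsWithin_neBot.mp hcl
    refine le_of_tendsto hc ?_
    filter_upwards [self_mem_nhdsWithin] with y hy
    exact ((h.mem_iff hy.2).mp hy.1).le
  · rw [hΩ.frontier_eq] at hqf
    exact not_lt.mp fun hlt => hqf.2 ((h.mem_iff hq).mpr hlt)

/-- A ball inside `Ω` that touches the boundary at `p` has its centre on the inner normal. -/
theorem normalize_gradient_eq (h : IsLocalDefiningFunction Ω p U ρ) (hΩ : IsOpen Ω)
    (hp : p ∈ frontier Ω) {x : EuclideanSpace ℝ (Fin N)} {s : ℝ} (hs : 0 < s)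
    (hb : Metric.ball x s ⊆ Ω) (hx : dist x p = s) :
    p - x = s • (‖gradient ρ p‖⁻¹ • gradient ρ p) := by
  have hpx : ‖p - x‖ = s := by rw [← hx, dist_comm, dist_eq_norm]
  have key : ‖gradient ρ p‖⁻¹ • gradient ρ p = s⁻¹ • (p - x) := by
    apply normalize_eq_of_halfSpace_subset
    · rw [norm_smul, hpx, Real.norm_of_nonneg (inv_nonneg.mpr hs.le), inv_mul_cancel₀ hs.ne']
    · exact h.gradient_ne_zero p h.mem
    · intro v hv
      rw [inner_smul_left, RCLike.conj_to_real] at hv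
      have hv' : inner ℝ (p - x) v < 0 := by
        by_contra hcon
        exact absurd hv (not_lt.mpr (mul_nonneg (inv_nonneg.mpr hs.le) (not_lt.mp hcon)))
      rw [inner_gradient_left]
      have hd : HasDerivAt (fun r : ℝ => ρ (p + r • v)) (fderiv ℝ ρ p v) 0 := by
        have h1 : HasFDerivAt ρ (fderiv ℝ ρ p) (p + (0 : ℝ) • v) := by
          simpa using (h.differentiableAt h.mem).hasFDerivAt
        have h2 : HasDerivAt (fun r : ℝ => p + r • v) v 0 := by
          simpa using ((hasDerivAt_id (0 : ℝ)).smul_const v).const_add p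
        exact h1.comp_hasDerivAt 0 h2
      refine le_of_tendsto hd.tendsto_slope_zero_right ?_
      have hU : ∀ᶠ r in 𝓝[>] (0 : ℝ), p + r • v ∈ U := by
        have hc : ContinuousAt (fun r : ℝ => p + r • v) 0 := by fun_prop
        exact (hc.eventually (h.isOpen.mem_nhds (by simpa using h.mem))).filter_mono
          nhdsWithin_le_nhds
      have hS : ∀ᶠ r in 𝓝[>] (0 : ℝ), 2 * inner ℝ (p - x) v + r * ‖v‖ ^ 2 < 0 := by
        have hc : ContinuousAt (fun r : ℝ => 2 * inner ℝ (p - x) v + r * ‖v‖ ^ 2) 0 := by fun_prop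
        exact (hc.eventually (gt_mem_nhds (by
          simp only [zero_mul, add_zero]; linarith))).filter_mono nhdsWithin_le_nhds
      filter_upwards [hU, hS, self_mem_nhdsWithin] with r hrU hrS hr
      have hr : 0 < r := hr
      have hin : p + r • v ∈ Metric.ball x s := by
        rw [mem_ball_iff_norm]
        have : ‖p + r • v - x‖ ^ 2 < s ^ 2 := by
          have e : p + r • v - x = (p - x) + r • v := by abel
          rw [e, norm_add_sq_real, hpx, inner_smul_right, norm_smul, mul_pow, Real.norm_eq_abs,
            sq_abs]
          nlinarith
        exact lt_of_pow_lt_pow_left₀ 2 hs.le this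
      have hneg := (h.mem_iff hrU).mp (hb hin)
      have h0 := h.eq_zero hΩ h.mem hp
      simp only [zero_add, zero_smul, add_zero, h0, sub_zero, smul_eq_mul]
      exact mul_nonpos_of_nonneg_of_nonpos (inv_nonneg.mpr hr.le) hneg.le
  rw [key, smul_smul, mul_inv_cancel₀ hs.ne', one_smul]

/-- Near a boundary point the domain has an interior touching ball of a fixed radius: with `m` a
lower bound of the length of the gradient of `ρ` and `K` a Lipschitz constant of its derivative,
every radius below `m / (2 K)` that keeps the ball in `U` will do. -/
theorem exists_interior_ball (h : IsLocalDefiningFunction Ω p U ρ) (hΩ : IsOpen Ω) :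
    ∃ r > 0, ∃ R > 0, ∀ q ∈ frontier Ω ∩ Metric.ball p r, q ∈ U ∧
      Metric.ball (q - R • (‖gradient ρ q‖⁻¹ • gradient ρ q)) R ⊆ Ω := by
  have hC1 : ContDiffAt ℝ 1 (fderiv ℝ ρ) p :=
    (h.contDiffOn.fderiv_of_isOpen h.isOpen (by norm_num)).contDiffAt (h.isOpen.mem_nhds h.mem)
  obtain ⟨K, T, hT, hK⟩ := hC1.exists_lipschitzOnWith
  have hm0 : 0 < ‖gradient ρ p‖ := norm_pos_iff.mpr (h.gradient_ne_zero p h.mem)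
  set m := ‖gradient ρ p‖ / 2 with hm
  have hmpos : 0 < m := by positivity
  have hgr : ∀ᶠ q in 𝓝 p, m < ‖gradient ρ q‖ :=
    (h.continuousAt_gradient h.mem).norm.eventually (lt_mem_nhds (by rw [hm]; linarith))
  obtain ⟨r, hr, hball⟩ := Metric.mem_nhds_iff.mp
    (inter_mem (inter_mem hT (h.isOpen.mem_nhds h.mem)) hgr)
  set R := min (r / 4) (m / (2 * (K + 1))) with hR
  have hK0 : (0 : ℝ) ≤ K := K.coe_nonneg
  have hRpos : 0 < R := by positivity
  refine ⟨r / 2, by positivity, R, hRpos, fun q ⟨hqf, hqb⟩ => ?_⟩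
  have hqb' : dist q p < r / 2 := hqb
  have hq := hball (Metric.mem_ball.mpr (by linarith : dist q p < r))
  refine ⟨hq.1.2, fun x hx => ?_⟩
  set g := gradient ρ q with hg
  have hgm : m < ‖g‖ := hq.2
  have hgpos : 0 < ‖g‖ := hmpos.trans hgm
  set ν := ‖g‖⁻¹ • g with hν
  have hν1 : ‖ν‖ = 1 := by
    rw [hν, norm_smul, norm_inv, norm_norm, inv_mul_cancel₀ hgpos.ne']
  have hgν : g = ‖g‖ • ν := by rw [hν, smul_smul, mul_inv_cancel₀ hgpos.ne', one_smul]
  have hx1 : ‖x - q‖ ^ 2 + 2 * R * inner ℝ ν (x - q) < 0 := by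
    rw [mem_ball_iff_norm] at hx
    have e : x - (q - R • ν) = (x - q) + R • ν := by abel
    rw [e] at hx
    have h2 : ‖(x - q) + R • ν‖ ^ 2 < R ^ 2 := pow_lt_pow_left₀ hx (norm_nonneg _) (by norm_num)
    rw [norm_add_sq_real, norm_smul, hν1, inner_smul_right, real_inner_comm, Real.norm_eq_abs,
      mul_one, sq_abs] at h2
    linarith
  have hx2 : ‖x - q‖ < 2 * R := by
    have h3 : |inner ℝ ν (x - q)| ≤ ‖ν‖ * ‖x - q‖ := abs_real_inner_le_norm _ _
    rw [hν1, one_mul] at h3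
    have h4 := (abs_le.mp h3).1
    nlinarith [norm_nonneg (x - q)]
  have hRr : R ≤ r / 4 := min_le_left _ _
  have hRm : R * (2 * (K + 1)) ≤ m := by
    have : R ≤ m / (2 * (K + 1)) := min_le_right _ _
    rwa [le_div_iff₀ (by positivity)] at this
  have hxp : x ∈ Metric.ball p r := by
    have := dist_triangle x q p
    rw [dist_eq_norm x q] at this
    rw [Metric.mem_ball]; linarith
  have hS : ‖ρ x - ρ q - fderiv ℝ ρ q (x - q)‖ ≤ (K * ‖x - q‖) * ‖x - q‖ := by
    refine Convex.norm_image_sub_le_of_norm_fderiv_le' (𝕜 := ℝ)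
      (s := Metric.ball p r ∩ Metric.closedBall q ‖x - q‖) ?_ ?_
      ((convex_ball _ _).inter (convex_closedBall _ _)) ?_ ?_
    · exact fun y hy => h.differentiableAt (hball hy.1).1.2
    · intro y hy
      have h5 := hK.dist_le_mul y (hball hy.1).1.1 q hq.1.1
      rw [dist_eq_norm] at h5
      exact h5.trans (mul_le_mul_of_nonneg_left hy.2 hK0)
    · exact ⟨Metric.mem_ball.mpr (by linarith), Metric.mem_closedBall_self (norm_nonneg _)⟩
    · exact ⟨hxp, by rw [Metric.mem_closedBall, dist_eq_norm]⟩
  rw [h.eq_zero hΩ hq.1.2 hqf, sub_zero, ← inner_gradient_left, ← hg] at hS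
  rw [h.mem_iff (hball hxp).1.2]
  have h6 := (abs_le.mp hS).2
  have h7 : inner ℝ g (x - q) = ‖g‖ * inner ℝ ν (x - q) := by
    conv_lhs => rw [hgν]
    rw [inner_smul_left, RCLike.conj_to_real]
  have h8 : 2 * R * ρ x < 0 := by
    have hneg : inner ℝ ν (x - q) < 0 := by
      by_contra hcon
      have : 0 ≤ 2 * R * inner ℝ ν (x - q) := mul_nonneg (by positivity) (not_lt.mp hcon)
      nlinarith [sq_nonneg ‖x - q‖]
    have h9 : ‖g‖ * inner ℝ ν (x - q) ≤ m * inner ℝ ν (x - q) :=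
      mul_le_mul_of_nonpos_right hgm.le hneg.le
    have h10 : ρ x ≤ m * inner ℝ ν (x - q) + K * ‖x - q‖ ^ 2 := by nlinarith
    have h11 : 2 * R * ρ x ≤ m * (2 * R * inner ℝ ν (x - q)) + 2 * R * K * ‖x - q‖ ^ 2 := by
      nlinarith
    have h12 : 2 * R * K * ‖x - q‖ ^ 2 ≤ m * ‖x - q‖ ^ 2 :=
      mul_le_mul_of_nonneg_right (by nlinarith) (sq_nonneg _)
    have h13 : m * (‖x - q‖ ^ 2 + 2 * R * inner ℝ ν (x - q)) < 0 :=
      mul_neg_of_pos_of_neg hmpos hx1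
    linarith
  by_contra hcon
  exact absurd h8 (not_lt.mpr (mul_nonneg (by positivity) (not_lt.mp hcon)))

end IsLocalDefiningFunction

/-- `n` is a continuous exterior unit normal on `∂Ω`, the balls of radius `R` touching `∂Ω` from
inside lie in `Ω`, and every ball in `Ω` touching `∂Ω` has its centre on the inner normal. -/
structure IsNormalField (Ω : Set (EuclideanSpace ℝ (Fin N))) (R : ℝ)
    (n : EuclideanSpace ℝ (Fin N) → EuclideanSpace ℝ (Fin N)) : Prop where
  pos : 0 < R
  continuousOn : ContinuousOn n (frontier Ω)
  isOuterUnitNormal : ∀ p ∈ frontier Ω, IsOuterUnitNormal Ω p (n p)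
  norm_eq_one : ∀ p ∈ frontier Ω, ‖n p‖ = 1
  ball_subset : ∀ p ∈ frontier Ω, Metric.ball (p - R • n p) R ⊆ Ω
  eq_smul : ∀ p ∈ frontier Ω, ∀ x s, 0 < s → Metric.ball x s ⊆ Ω → dist x p = s →
    p - x = s • n p

theorem HasC2Boundary.exists_isNormalField (h : HasC2Boundary Ω) (hΩ : IsOpen Ω)
    (hbdd : Bornology.IsBounded Ω) : ∃ R n, IsNormalField Ω R n := by
  choose! U ρ hρ using h
  set n : EuclideanSpace ℝ (Fin N) → EuclideanSpace ℝ (Fin N) :=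
    fun p => ‖gradient (ρ p) p‖⁻¹ • gradient (ρ p) p with hn
  have hn1 : ∀ p ∈ frontier Ω, ‖n p‖ = 1 := fun p hp => by
    have hpos := norm_pos_iff.mpr ((hρ p hp).gradient_ne_zero p (hρ p hp).mem)
    rw [hn]
    simp only
    rw [norm_smul, norm_inv, norm_norm, inv_mul_cancel₀ hpos.ne']
  have heq : ∀ p ∈ frontier Ω, ∀ x s, 0 < s → Metric.ball x s ⊆ Ω → dist x p = s →
      p - x = s • n p := fun p hp x s hs hb hx =>
    (hρ p hp).normalize_gradient_eq hΩ hp hs hb hx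
  -- The interior balls identify the normals obtained from different defining functions.
  have hloc : ∀ p ∈ frontier Ω, ∃ r > 0, ∃ R > 0, ∀ q ∈ frontier Ω ∩ Metric.ball p r,
      q ∈ U p ∧ n q = ‖gradient (ρ p) q‖⁻¹ • gradient (ρ p) q ∧
        Metric.ball (q - R • n q) R ⊆ Ω := by
    intro p hp
    obtain ⟨r, hr, R, hR, hq⟩ := (hρ p hp).exists_interior_ball hΩ
    refine ⟨r, hr, R, hR, fun q hqm => ?_⟩
    obtain ⟨hqU, hqb⟩ := hq q hqm
    have hpos := norm_pos_iff.mpr ((hρ p hp).gradient_ne_zero q hqU)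
    have hd : dist (q - R • (‖gradient (ρ p) q‖⁻¹ • gradient (ρ p) q)) q = R := by
      rw [dist_eq_norm, sub_sub_cancel_left, norm_neg, norm_smul, norm_smul, norm_inv, norm_norm,
        inv_mul_cancel₀ hpos.ne', mul_one, Real.norm_of_nonneg hR.le]
    have h1 := heq q hqm.1 _ R hR hqb hd
    rw [sub_sub_cancel] at h1
    have h2 := smul_right_injective _ hR.ne' h1
    exact ⟨hqU, h2.symm, by rw [← h2]; exact hqb⟩
  have hcont : ContinuousOn n (frontier Ω) := by
    intro p hp
    obtain ⟨r, hr, R, hR, hq⟩ := hloc p hp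
    have hg := (hρ p hp).continuousAt_gradient (hρ p hp).mem
    have hne := (hρ p hp).gradient_ne_zero p (hρ p hp).mem
    have hc : ContinuousWithinAt (fun q => ‖gradient (ρ p) q‖⁻¹ • gradient (ρ p) q)
        (frontier Ω) p :=
      ((hg.norm.inv₀ (norm_ne_zero_iff.mpr hne)).smul hg).continuousWithinAt
    refine hc.congr_of_eventuallyEq ?_ rfl
    filter_upwards [self_mem_nhdsWithin, nhdsWithin_le_nhds (Metric.ball_mem_nhds p hr)]
      with q h1 h2 using (hq q ⟨h1, h2⟩).2.1
  have hcomp : IsCompact (frontier Ω) :=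
    Metric.isCompact_of_isClosed_isBounded isClosed_frontier
      (hbdd.closure.subset frontier_subset_closure)
  have huni : ∃ R > 0, ∀ p ∈ frontier Ω, p ∈ frontier Ω → Metric.ball (p - R • n p) R ⊆ Ω := by
    refine hcomp.induction_on (p := fun S => ∃ R > 0, ∀ p ∈ S, p ∈ frontier Ω →
      Metric.ball (p - R • n p) R ⊆ Ω) ⟨1, one_pos, by simp⟩ ?_ ?_ ?_
    · rintro s t hst ⟨R, hR, h⟩
      exact ⟨R, hR, fun p hp => h p (hst hp)⟩
    · rintro s t ⟨R, hR, h⟩ ⟨R', hR', h'⟩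
      -- Interior touching balls of smaller radius lie in those of larger radius.
      have hsub : ∀ p ∈ frontier Ω, ∀ a b : ℝ, 0 < a → a ≤ b →
          Metric.ball (p - a • n p) a ⊆ Metric.ball (p - b • n p) b := by
        intro p hp a b _ hab
        apply Metric.ball_subset_ball'
        rw [dist_eq_norm, sub_sub_sub_cancel_left, ← sub_smul, norm_smul, hn1 p hp,
          Real.norm_of_nonneg (by linarith)]
        linarith
      refine ⟨min R R', lt_min hR hR', ?_⟩
      rintro p (hp | hp) hpf
      · exact (hsub p hpf _ _ (lt_min hR hR') (min_le_left _ _)).trans (h p hp hpf)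
      · exact (hsub p hpf _ _ (lt_min hR hR') (min_le_right _ _)).trans (h' p hp hpf)
    · intro p hp
      obtain ⟨r, hr, R, hR, hq⟩ := hloc p hp
      exact ⟨Metric.ball p r, nhdsWithin_le_nhds (Metric.ball_mem_nhds p hr), R, hR,
        fun q h1 h2 => (hq q ⟨h2, h1⟩).2.2⟩
  obtain ⟨R, hR, hb⟩ := huni
  exact ⟨R, n, hR, hcont, fun p hp => ⟨hp, U p, ρ p, hρ p hp, rfl⟩, hn1,
    fun p hp => hb p hp hp, heq⟩

end Boundary

/-! ### The distance to the boundary -/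

section Distance

variable {N : ℕ} {Ω : Set (EuclideanSpace ℝ (Fin N))}

theorem ball_infDist_frontier_subset (hΩ : IsOpen Ω) {x : EuclideanSpace ℝ (Fin N)} (hx : x ∈ Ω) :
    Metric.ball x (Metric.infDist x (frontier Ω)) ⊆ Ω := by
  rcases lt_or_ge 0 (Metric.infDist x (frontier Ω)) with h | h
  · refine (convex_ball x _).isPreconnected.subset_left_of_subset_union hΩ
      isClosed_closure.isOpen_compl (disjoint_left.mpr fun y hy hy' => hy' (subset_closure hy))
      (fun y hy => ?_) ⟨x, Metric.mem_ball_self h, hx⟩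
    by_cases hyc : y ∈ closure Ω
    · left
      by_contra hyΩ
      have hyf : y ∈ frontier Ω := by rw [hΩ.frontier_eq]; exact ⟨hyc, hyΩ⟩
      have := Metric.infDist_le_dist_of_mem (x := x) hyf
      rw [Metric.mem_ball, dist_comm] at hy
      linarith
    · exact Or.inr hyc
  · rw [Metric.ball_eq_empty.mpr h]
    exact empty_subset _

theorem infDist_frontier_pos (hΩ : IsOpen Ω) (hne : (frontier Ω).Nonempty)
    {x : EuclideanSpace ℝ (Fin N)} (hx : x ∈ Ω) : 0 < Metric.infDist x (frontier Ω) := by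
  refine (isClosed_frontier.notMem_iff_infDist_pos hne).mp fun h => ?_
  rw [hΩ.frontier_eq] at h
  exact h.2 hx

/-- The distance to the boundary is bounded below by that of any ball inside the domain. -/
theorem sub_dist_le_infDist_frontier (hΩ : IsOpen Ω) (hne : (frontier Ω).Nonempty)
    {x y : EuclideanSpace ℝ (Fin N)} {s : ℝ} (h : Metric.ball y s ⊆ Ω) :
    s - dist x y ≤ Metric.infDist x (frontier Ω) := by
  refine (Metric.le_infDist hne).mpr fun p hp => ?_
  have hps : s ≤ dist p y := by
    by_contra hlt
    rw [hΩ.frontier_eq] at hp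
    exact hp.2 (h (not_le.mp hlt))
  have := dist_triangle p x y
  rw [dist_comm p x] at this
  linarith

theorem nonempty_frontier_of_isBounded (hN : N ≠ 0) (hbdd : Bornology.IsBounded Ω)
    (hΩ : Ω.Nonempty) : (frontier Ω).Nonempty := by
  have : NeZero N := ⟨hN⟩
  rw [nonempty_frontier_iff]
  refine ⟨hΩ, ?_⟩
  rintro rfl
  exact NormedSpace.unbounded_univ ℝ (EuclideanSpace ℝ (Fin N)) hbdd

theorem isCompact_closure_of_isBounded (hbdd : Bornology.IsBounded Ω) : IsCompact (closure Ω) :=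
  Metric.isCompact_of_isClosed_isBounded isClosed_closure hbdd.closure

theorem isCompact_frontier_of_isBounded (hbdd : Bornology.IsBounded Ω) :
    IsCompact (frontier Ω) :=
  (isCompact_closure_of_isBounded hbdd).of_isClosed_subset isClosed_frontier
    frontier_subset_closure

theorem isCompact_parallelSurface (hΩ : IsOpen Ω) (hbdd : Bornology.IsBounded Ω) {t : ℝ}
    (ht : 0 < t) : IsCompact (parallelSurface Ω t) := by
  have : parallelSurface Ω t = closure Ω ∩ {x | Metric.infDist x (frontier Ω) = t} := by
    ext x
    refine ⟨fun h => ⟨subset_closure h.1, h.2⟩, fun h => ⟨?_, h.2⟩⟩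
    by_contra hx
    have hxf : x ∈ frontier Ω := by rw [hΩ.frontier_eq]; exact ⟨h.1, hx⟩
    have h0 := Metric.infDist_zero_of_mem hxf
    have h2 : Metric.infDist x (frontier Ω) = t := h.2
    linarith
  rw [this]
  exact (isCompact_closure_of_isBounded hbdd).inter_right
    (isClosed_eq (Metric.continuous_infDist_pt _) continuous_const)

/-- Along the segment from a point of `Ω` to a nearest boundary point the distance to the boundary
takes all the smaller positive values. -/
theorem eventually_parallelSurface_nonempty (hΩ : IsOpen Ω) (hbdd : Bornology.IsBounded Ω)
    (hne : Ω.Nonempty) (hfne : (frontier Ω).Nonempty) :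
    ∀ᶠ t in 𝓝[>] (0 : ℝ), (parallelSurface Ω t).Nonempty := by
  obtain ⟨x, hx⟩ := hne
  obtain ⟨p, hp, hpd⟩ := (isCompact_frontier_of_isBounded hbdd).exists_infDist_eq_dist hfne x
  have hd := infDist_frontier_pos hΩ hfne hx
  set d := Metric.infDist x (frontier Ω) with hdef
  have hxp : ‖x - p‖ = d := by rw [hpd, dist_eq_norm]
  filter_upwards [Ioo_mem_nhdsGT hd] with t ht
  have h1 : dist (p + (t / d) • (x - p)) p = t := by
    rw [dist_eq_norm, add_sub_cancel_left, norm_smul, hxp,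
      Real.norm_of_nonneg (div_nonneg ht.1.le hd.le), div_mul_cancel₀ _ hd.ne']
  have h2 : dist (p + (t / d) • (x - p)) x = d - t := by
    have e : p + (t / d) • (x - p) - x = (t / d - 1) • (x - p) := by module
    rw [dist_eq_norm, e, norm_smul, hxp, Real.norm_of_nonpos, neg_sub, sub_mul,
      div_mul_cancel₀ _ hd.ne', one_mul]
    rw [sub_nonpos, div_le_one hd]
    exact ht.2.le
  have hb := ball_infDist_frontier_subset hΩ hx
  refine ⟨p + (t / d) • (x - p), hb ?_, le_antisymm ?_ ?_⟩
  · rw [Metric.mem_ball, h2]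
    linarith [ht.1]
  · exact (Metric.infDist_le_dist_of_mem hp).trans h1.le
  · have := sub_dist_le_infDist_frontier hΩ hfne hb (x := p + (t / d) • (x - p))
    rw [h2] at this
    linarith

namespace IsNormalField

variable {R : ℝ} {n : EuclideanSpace ℝ (Fin N) → EuclideanSpace ℝ (Fin N)}

theorem exists_foot (h : IsNormalField Ω R n) (hΩ : IsOpen Ω) (hbdd : Bornology.IsBounded Ω)
    (hne : (frontier Ω).Nonempty) {x : EuclideanSpace ℝ (Fin N)} (hx : x ∈ Ω) :
    ∃ p ∈ frontier Ω, x = p - Metric.infDist x (frontier Ω) • n p := by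
  obtain ⟨p, hp, hpd⟩ := (isCompact_frontier_of_isBounded hbdd).exists_infDist_eq_dist hne x
  refine ⟨p, hp, ?_⟩
  rw [← h.eq_smul p hp x _ (infDist_frontier_pos hΩ hne hx)
    (ball_infDist_frontier_subset hΩ hx) hpd.symm, sub_sub_cancel]

theorem sub_smul_mem (h : IsNormalField Ω R n) {p : EuclideanSpace ℝ (Fin N)}
    (hp : p ∈ frontier Ω) {s : ℝ} (hs : 0 < s) (hsR : s ≤ R) : p - s • n p ∈ Ω := by
  apply h.ball_subset p hp
  rw [Metric.mem_ball, dist_eq_norm, sub_sub_sub_cancel_left, ← sub_smul, norm_smul,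
    h.norm_eq_one p hp, mul_one, Real.norm_of_nonneg (by linarith)]
  linarith

theorem norm_smul_normal (h : IsNormalField Ω R n) {p : EuclideanSpace ℝ (Fin N)}
    (hp : p ∈ frontier Ω) {s : ℝ} (hs : 0 ≤ s) : ‖s • n p‖ = s := by
  rw [norm_smul, h.norm_eq_one p hp, mul_one, Real.norm_of_nonneg hs]

/-- The interior touching ball and the ball of radius `d(z)` about `z` squeeze a parallel surface
near `z` between two paraboloids; this is the inner one. -/
theorem neg_le_inner_sub (h : IsNormalField Ω R n) (hΩ : IsOpen Ω)
    (hne : (frontier Ω).Nonempty) {p z w : EuclideanSpace ℝ (Fin N)} (hp : p ∈ frontier Ω)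
    {t : ℝ} (hz : z = p - t • n p) (htR : t ≤ R / 2)
    (hw : Metric.infDist w (frontier Ω) = t) :
    -‖w - z‖ ^ 2 ≤ R * inner ℝ (n p) (w - z) := by
  have hR := h.pos
  have h1 := sub_dist_le_infDist_frontier hΩ hne (h.ball_subset p hp) (x := w)
  rw [hw, dist_eq_norm] at h1
  have e : w - (p - R • n p) = (w - z) + (R - t) • n p := by rw [hz]; module
  have h2 : (R - t) ^ 2 ≤ ‖(w - z) + (R - t) • n p‖ ^ 2 := by
    rw [← e]
    exact pow_le_pow_left₀ (by linarith) (by linarith) 2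
  rw [norm_add_sq_real, h.norm_smul_normal hp (by linarith), inner_smul_right,
    real_inner_comm] at h2
  by_contra hcon
  have h3 : inner ℝ (n p) (w - z) < 0 := by
    by_contra hc
    have : 0 ≤ R * inner ℝ (n p) (w - z) := mul_nonneg hR.le (not_lt.mp hc)
    nlinarith [sq_nonneg ‖w - z‖]
  nlinarith

/-- The outer paraboloid bounding a parallel surface near one of its points. -/
theorem inner_sub_le (h : IsNormalField Ω R n) {p z w : EuclideanSpace ℝ (Fin N)}
    (hp : p ∈ frontier Ω) {t : ℝ} (ht : 0 < t) (hz : z = p - t • n p)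
    (hw : Metric.infDist w (frontier Ω) = t) :
    2 * t * inner ℝ (n p) (w - z) ≤ ‖w - z‖ ^ 2 := by
  have h1 := Metric.infDist_le_dist_of_mem (x := w) hp
  rw [hw, dist_eq_norm] at h1
  have e : w - p = (w - z) - t • n p := by rw [hz]; module
  have h2 : t ^ 2 ≤ ‖(w - z) - t • n p‖ ^ 2 := by
    rw [← e]
    exact pow_le_pow_left₀ ht.le h1 2
  rw [norm_sub_sq_real, h.norm_smul_normal hp ht.le, inner_smul_right, real_inner_comm] at h2
  linarith

end IsNormalField

end Distance

/-! ### First-order expansion at the boundary -/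

section FirstOrder

variable {N : ℕ} {Ω : Set (EuclideanSpace ℝ (Fin N))} {u : EuclideanSpace ℝ (Fin N) → ℝ}

theorem IsCkUpToBoundary.exists_fderiv_extension {k : ℕ} (h : IsCkUpToBoundary k Ω u)
    (hk : 1 ≤ k) (hΩ : IsOpen Ω) :
    ∃ D : EuclideanSpace ℝ (Fin N) → EuclideanSpace ℝ (Fin N) →L[ℝ] ℝ,
      ContinuousOn D (closure Ω) ∧ ∀ x ∈ Ω, HasFDerivAt u (D x) x := by
  obtain ⟨-, h2, h3⟩ := h
  obtain ⟨G, hG, hGe⟩ := h3 1 hk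
  refine ⟨fun x => continuousMultilinearCurryFin1 ℝ (EuclideanSpace ℝ (Fin N)) ℝ (G x),
    (continuousMultilinearCurryFin1 ℝ (EuclideanSpace ℝ (Fin N)) ℝ).continuous.comp_continuousOn hG, fun x hx => ?_⟩
  have hd : DifferentiableAt ℝ u x :=
    (h2.differentiableOn (by exact_mod_cast (by omega : k ≠ 0))).differentiableAt
      (hΩ.mem_nhds hx)
  convert hd.hasFDerivAt using 1
  ext v
  rw [continuousMultilinearCurryFin1_apply, ← hGe hx, iteratedFDeriv_one_apply]
  rfl

theorem hasDerivAt_comp_line {D : EuclideanSpace ℝ (Fin N) →L[ℝ] ℝ}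
    {x v : EuclideanSpace ℝ (Fin N)} {s : ℝ} (h : HasFDerivAt u D (x + s • v)) :
    HasDerivAt (fun r : ℝ => u (x + r • v)) (D v) s := by
  have h2 : HasDerivAt (fun r : ℝ => x + r • v) v s := by
    simpa using ((hasDerivAt_id s).smul_const v).const_add x
  exact h.comp_hasDerivAt s h2

variable {R c : ℝ} {n : EuclideanSpace ℝ (Fin N) → EuclideanSpace ℝ (Fin N)}
  {D : EuclideanSpace ℝ (Fin N) → EuclideanSpace ℝ (Fin N) →L[ℝ] ℝ}

/-- The continuous extension of the gradient has normal component `c` on the boundary. -/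
theorem IsNormalField.extension_apply_normal (h : IsNormalField Ω R n)
    (huc : ContinuousOn u (closure Ω)) (hDc : ContinuousOn D (closure Ω))
    (hD : ∀ x ∈ Ω, HasFDerivAt u (D x) x) {p : EuclideanSpace ℝ (Fin N)} (hp : p ∈ frontier Ω)
    (hc : HasNormalDerivAt u p (n p) c) : D p (n p) = c := by
  have hmem : ∀ s ∈ Ioo (-R) 0, p + s • n p ∈ Ω := fun s hs => by
    have := h.sub_smul_mem hp (s := -s) (by linarith [hs.2]) (by linarith [hs.1])
    rwa [neg_smul, sub_neg_eq_add] at this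
  have hder : ∀ s ∈ Ioo (-R) 0, HasDerivAt (fun r : ℝ => u (p + r • n p)) (D (p + s • n p) (n p)) s :=
    fun s hs => hasDerivAt_comp_line (hD _ (hmem s hs))
  have hline : ContinuousWithinAt (fun r : ℝ => p + r • n p) (Ioo (-R) 0) 0 := by fun_prop
  have hmaps : MapsTo (fun r : ℝ => p + r • n p) (Ioo (-R) 0) (closure Ω) :=
    fun s hs => subset_closure (hmem s hs)
  have hp0 : p = p + (0 : ℝ) • n p := by simp
  have hpc : p + (0 : ℝ) • n p ∈ closure Ω := by
    rw [← hp0]; exact frontier_subset_closure hp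
  have hIoo : Ioo (-R) 0 ∈ 𝓝[<] (0 : ℝ) := Ioo_mem_nhdsLT (by linarith [h.pos])
  have h1 : HasDerivWithinAt (fun r : ℝ => u (p + r • n p)) (D p (n p)) (Iic 0) 0 := by
    refine hasDerivWithinAt_Iic_of_tendsto_deriv (s := Ioo (-R) 0)
      (fun s hs => (hder s hs).differentiableAt.differentiableWithinAt) ?_ hIoo ?_
    · exact ContinuousWithinAt.comp (t := closure Ω) (huc _ hpc) hline hmaps
    · have h2 : ContinuousWithinAt (fun r : ℝ => D (p + r • n p) (n p)) (Ioo (-R) 0) 0 :=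
        (ContinuousWithinAt.comp (t := closure Ω) (f := fun r : ℝ => p + r • n p) (x := 0)
          (hDc _ hpc) hline hmaps).clm_apply continuousWithinAt_const
      have h3 : Tendsto (fun r : ℝ => D (p + r • n p) (n p)) (𝓝[<] 0) (𝓝 (D p (n p))) := by
        have := h2.tendsto.mono_left (nhdsWithin_le_of_mem hIoo)
        simpa using this
      refine h3.congr' ?_
      filter_upwards [hIoo] with s hs using (hder s hs).deriv.symm
  exact (uniqueDiffWithinAt_Iic (0 : ℝ)).eq_deriv _ h1 hc

theorem foot_sub_smul_mem (hΩ : IsOpen Ω) {x p ν : EuclideanSpace ℝ (Fin N)}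
    (hx : x ∈ Ω) (hν : ‖ν‖ = 1) (hxp : x = p - Metric.infDist x (frontier Ω) • ν) {s : ℝ}
    (hs : s ∈ Ioc 0 (Metric.infDist x (frontier Ω))) : p + s • (-ν) ∈ Ω := by
  apply ball_infDist_frontier_subset hΩ hx
  have e : p + s • (-ν) - x = (Metric.infDist x (frontier Ω) - s) • ν := by
    nth_rw 1 [hxp]; module
  rw [Metric.mem_ball, dist_eq_norm, e, norm_smul, hν, Real.norm_of_nonneg (by linarith [hs.2])]
  linarith [hs.1]

/-- `u = -c d + o(d)` uniformly near the boundary, `d` the distance to the boundary. -/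
theorem IsNormalField.abs_add_mul_infDist_le (h : IsNormalField Ω R n) (hΩ : IsOpen Ω)
    (hbdd : Bornology.IsBounded Ω) (hne : (frontier Ω).Nonempty)
    (huc : ContinuousOn u (closure Ω)) (hDc : ContinuousOn D (closure Ω))
    (hD : ∀ x ∈ Ω, HasFDerivAt u (D x) x) (hu0 : ∀ p ∈ frontier Ω, u p = 0)
    (hDn : ∀ p ∈ frontier Ω, D p (n p) = c) {η : ℝ} (hη : 0 < η) :
    ∃ δ > 0, ∀ x ∈ Ω, Metric.infDist x (frontier Ω) < δ →
      |u x + c * Metric.infDist x (frontier Ω)| ≤ η * Metric.infDist x (frontier Ω) := by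
  obtain ⟨δ, hδ, hunif⟩ := Metric.uniformContinuousOn_iff.mp
    ((isCompact_closure_of_isBounded hbdd).uniformContinuousOn_of_continuous hDc) η hη
  refine ⟨δ, hδ, fun x hx hxδ => ?_⟩
  obtain ⟨p, hp, hxp⟩ := h.exists_foot hΩ hbdd hne hx
  have ht := infDist_frontier_pos hΩ hne hx
  have hν := h.norm_eq_one p hp
  have hmem : ∀ s ∈ Ioc 0 (Metric.infDist x (frontier Ω)), p + s • (-n p) ∈ Ω :=
    fun s hs => foot_sub_smul_mem hΩ hx hν hxp hs
  set t := Metric.infDist x (frontier Ω) with htdef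
  have hcont : ContinuousOn (fun s : ℝ => u (p + s • (-n p))) (Icc 0 t) := by
    refine huc.comp (by fun_prop) fun s hs => ?_
    rcases hs.1.eq_or_lt with h0 | h0
    · rw [← h0]; simpa using frontier_subset_closure hp
    · exact subset_closure (hmem s ⟨h0, hs.2⟩)
  obtain ⟨s, hs, hsl⟩ := exists_hasDerivAt_eq_slope (fun s : ℝ => u (p + s • (-n p)))
    (fun s => D (p + s • (-n p)) (-n p)) ht hcont
    (fun s hs => hasDerivAt_comp_line (hD _ (hmem s ⟨hs.1, hs.2.le⟩)))
  have hxt : p + t • (-n p) = x := by rw [smul_neg, ← sub_eq_add_neg, ← hxp]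
  rw [sub_zero, hxt, zero_smul, add_zero, hu0 p hp, sub_zero, map_neg,
    eq_div_iff ht.ne'] at hsl
  have hclose : dist (D (p + s • (-n p))) (D p) < η := by
    refine hunif _ (subset_closure (hmem s ⟨hs.1, hs.2.le⟩)) _ (frontier_subset_closure hp) ?_
    rw [dist_eq_norm, add_sub_cancel_left, smul_neg, norm_neg, h.norm_smul_normal hp hs.1.le]
    linarith [hs.2]
  have hb : |D (p + s • (-n p)) (n p) - c| ≤ η := by
    rw [← hDn p hp, ← sub_apply, ← Real.norm_eq_abs]
    refine (ContinuousLinearMap.le_opNorm _ _).trans ?_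
    rw [hν, mul_one, ← dist_eq_norm]
    exact hclose.le
  rw [← hsl]
  have e : -D (p + s • (-n p)) (n p) * t + c * t = -(D (p + s • (-n p)) (n p) - c) * t := by ring
  rw [e, abs_mul, abs_neg, abs_of_pos ht]
  exact mul_le_mul_of_nonneg_right hb ht.le

end FirstOrder

/-! ### Second-order expansion at the boundary -/

section SecondOrder

/-- A second-order Taylor estimate for a function that is twice differentiable only in the interior
of the interval, with oscillation of the second derivative controlling the error. -/
theorem abs_sub_quadratic_le {f f' f'' : ℝ → ℝ} {b h η : ℝ} (hb : 0 < b)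
    (hf : ContinuousOn f (Icc 0 b)) (hf' : ContinuousOn f' (Icc 0 b))
    (hd : ∀ s ∈ Ioo 0 b, HasDerivAt f (f' s) s) (hd' : ∀ s ∈ Ioo 0 b, HasDerivAt f' (f'' s) s)
    (hη : ∀ s ∈ Ioo 0 b, |f'' s - h| ≤ η) :
    |f b - f 0 - f' 0 * b - h * b ^ 2 / 2| ≤ η * b ^ 2 := by
  obtain ⟨s, hs, hs1⟩ := exists_hasDerivAt_eq_slope (fun s => f s - f' 0 * s - h * s ^ 2 / 2)
    (fun s => f' s - f' 0 - h * s) hb (by fun_prop) (fun s hs =>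
      (((hd s hs).fun_sub ((hasDerivAt_id' s).const_mul (f' 0))).fun_sub
        (((hasDerivAt_pow 2 s).const_mul h).div_const 2)).congr_deriv (by push_cast; ring))
  obtain ⟨r, hr, hr1⟩ := exists_hasDerivAt_eq_slope f' f'' hs.1
    (hf'.mono (Icc_subset_Icc_right hs.2.le)) (fun r hr => hd' r ⟨hr.1, hr.2.trans hs.2⟩)
  rw [sub_zero, eq_div_iff hb.ne'] at hs1
  rw [sub_zero, eq_div_iff hs.1.ne'] at hr1
  have e : f b - f 0 - f' 0 * b - h * b ^ 2 / 2 = (f'' r - h) * s * b := by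
    have e1 : f' s - f' 0 - h * s = (f'' r - h) * s := by rw [← hr1]; ring
    rw [e1] at hs1
    rw [hs1]; ring
  rw [e, abs_mul, abs_mul, abs_of_pos hs.1, abs_of_pos hb]
  have h1 := hη r ⟨hr.1, hr.2.trans hs.2⟩
  have h0 : 0 ≤ η := (abs_nonneg _).trans h1
  calc |f'' r - h| * s * b ≤ η * b * b :=
        mul_le_mul_of_nonneg_right (mul_le_mul h1 hs.2.le hs.1.le h0) hb.le
    _ = η * b ^ 2 := by ring

variable {N : ℕ} {Ω : Set (EuclideanSpace ℝ (Fin N))} {u : EuclideanSpace ℝ (Fin N) → ℝ}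

/-- The second derivative of a function in `C²(Ω̄)` extends to the closure as a bounded and
continuous quadratic form. -/
theorem IsCkUpToBoundary.exists_quadraticForm_extension (h : IsCkUpToBoundary 2 Ω u)
    (hbdd : Bornology.IsBounded Ω) :
    ∃ (Q : EuclideanSpace ℝ (Fin N) → EuclideanSpace ℝ (Fin N) → ℝ) (K : ℝ), 0 < K ∧
      ContinuousOn (Function.uncurry Q) (closure Ω ×ˢ univ) ∧
      (∀ x ∈ closure Ω, ∀ v, |Q x v| ≤ K * ‖v‖ ^ 2) ∧
      ∀ x ∈ Ω, ∀ v, fderiv ℝ (fderiv ℝ u) x v v = Q x v := by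
  obtain ⟨-, h2, h3⟩ := h
  obtain ⟨G, hG, hGe⟩ := h3 2 le_rfl
  obtain ⟨K, hK⟩ := (isCompact_closure_of_isBounded hbdd).exists_bound_of_continuousOn hG
  refine ⟨fun x v => G x ![v, v], max K 1, by positivity, ?_, ?_, ?_⟩
  · have h1 : ContinuousOn (fun q : EuclideanSpace ℝ (Fin N) × EuclideanSpace ℝ (Fin N) => G q.1)
        (closure Ω ×ˢ univ) := hG.comp continuousOn_fst fun q hq => hq.1
    have h2 : Continuous (fun q : EuclideanSpace ℝ (Fin N) × EuclideanSpace ℝ (Fin N) =>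
        (![q.2, q.2] : Fin 2 → EuclideanSpace ℝ (Fin N))) := by
      refine continuous_pi fun i => ?_
      fin_cases i <;> exact continuous_snd
    exact h1.eval h2.continuousOn
  · intro x hx v
    have h1 := (G x).le_opNorm ![v, v]
    rw [Fin.prod_univ_two] at h1
    simp only [Matrix.cons_val_zero, Matrix.cons_val_one] at h1
    rw [← Real.norm_eq_abs]
    refine h1.trans ?_
    rw [← sq]
    exact mul_le_mul_of_nonneg_right ((hK x hx).trans (le_max_left _ _)) (sq_nonneg _)
  · intro x hx v
    change _ = G x ![v, v]
    rw [← hGe hx, iteratedFDeriv_two_apply]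
    rfl

theorem hasDerivAt_apply_comp_line
    {D : EuclideanSpace ℝ (Fin N) → EuclideanSpace ℝ (Fin N) →L[ℝ] ℝ}
    {D' : EuclideanSpace ℝ (Fin N) →L[ℝ] EuclideanSpace ℝ (Fin N) →L[ℝ] ℝ}
    {x v : EuclideanSpace ℝ (Fin N)} {s : ℝ} (h : HasFDerivAt D D' (x + s • v)) :
    HasDerivAt (fun r : ℝ => D (x + r • v) v) (D' v v) s := by
  have h1 : HasDerivAt (fun r : ℝ => x + r • v) v s := by
    simpa using ((hasDerivAt_id s).smul_const v).const_add x
  exact (ContinuousLinearMap.apply ℝ ℝ v).hasFDerivAt.comp_hasDerivAt s (h.comp_hasDerivAt s h1)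

/-- A function `u` on a bounded domain with `u = 0`, `u_ν = c` on the boundary, whose first and
second derivatives extend to the closure as `D` and as the quadratic form `Q`, with `|Q| ≤ K`;
`n` and `R` are the exterior normal and a radius of interior touching balls. -/
structure IsCauchyData (Ω : Set (EuclideanSpace ℝ (Fin N))) (R : ℝ)
    (n : EuclideanSpace ℝ (Fin N) → EuclideanSpace ℝ (Fin N)) (u : EuclideanSpace ℝ (Fin N) → ℝ)
    (c : ℝ) (D : EuclideanSpace ℝ (Fin N) → EuclideanSpace ℝ (Fin N) →L[ℝ] ℝ)
    (Q : EuclideanSpace ℝ (Fin N) → EuclideanSpace ℝ (Fin N) → ℝ) (K : ℝ) : Prop where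
  isOpen : IsOpen Ω
  isBounded : Bornology.IsBounded Ω
  nonempty : (frontier Ω).Nonempty
  normal : IsNormalField Ω R n
  continuousOn : ContinuousOn u (closure Ω)
  continuousOn_deriv : ContinuousOn D (closure Ω)
  hasFDerivAt : ∀ x ∈ Ω, HasFDerivAt u (D x) x
  eq_zero : ∀ p ∈ frontier Ω, u p = 0
  deriv_normal : ∀ p ∈ frontier Ω, D p (n p) = c
  pos : 0 < K
  continuousOn_hess : ContinuousOn (Function.uncurry Q) (closure Ω ×ˢ univ)
  abs_hess_le : ∀ x ∈ closure Ω, ∀ v, |Q x v| ≤ K * ‖v‖ ^ 2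
  hasDerivAt_deriv : ∀ (x v : EuclideanSpace ℝ (Fin N)) (s : ℝ), x + s • v ∈ Ω →
    HasDerivAt (fun r : ℝ => D (x + r • v) v) (Q (x + s • v) v) s

namespace IsCauchyData

variable {R c K : ℝ} {n : EuclideanSpace ℝ (Fin N) → EuclideanSpace ℝ (Fin N)}
  {D : EuclideanSpace ℝ (Fin N) → EuclideanSpace ℝ (Fin N) →L[ℝ] ℝ}
  {Q : EuclideanSpace ℝ (Fin N) → EuclideanSpace ℝ (Fin N) → ℝ}

theorem neg (h : IsCauchyData Ω R n u c D Q K) :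
    IsCauchyData Ω R n (fun x => -u x) (-c) (fun x => -D x) (fun x v => -Q x v) K where
  isOpen := h.isOpen
  isBounded := h.isBounded
  nonempty := h.nonempty
  normal := h.normal
  continuousOn := h.continuousOn.neg
  continuousOn_deriv := h.continuousOn_deriv.neg
  hasFDerivAt x hx := (h.hasFDerivAt x hx).neg
  eq_zero p hp := by simp [h.eq_zero p hp]
  deriv_normal p hp := by simp [h.deriv_normal p hp]
  pos := h.pos
  continuousOn_hess := h.continuousOn_hess.neg
  abs_hess_le x hx v := by simpa using h.abs_hess_le x hx v
  hasDerivAt_deriv x v s hs := by simpa using (h.hasDerivAt_deriv x v s hs).fun_neg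

theorem exists_foot (h : IsCauchyData Ω R n u c D Q K) {x : EuclideanSpace ℝ (Fin N)}
    (hx : x ∈ Ω) : ∃ p ∈ frontier Ω, x = p - Metric.infDist x (frontier Ω) • n p :=
  h.normal.exists_foot h.isOpen h.isBounded h.nonempty hx

theorem infDist_pos (h : IsCauchyData Ω R n u c D Q K) {x : EuclideanSpace ℝ (Fin N)}
    (hx : x ∈ Ω) : 0 < Metric.infDist x (frontier Ω) :=
  infDist_frontier_pos h.isOpen h.nonempty hx

theorem foot_sub_smul_mem_closure (h : IsCauchyData Ω R n u c D Q K)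
    {x p : EuclideanSpace ℝ (Fin N)} (hx : x ∈ Ω) (hp : p ∈ frontier Ω)
    (hxp : x = p - Metric.infDist x (frontier Ω) • n p) :
    MapsTo (fun s : ℝ => p + s • (-n p)) (Icc 0 (Metric.infDist x (frontier Ω))) (closure Ω) := by
  intro s hs
  rcases hs.1.eq_or_lt with h0 | h0
  · simpa [← h0] using frontier_subset_closure hp
  · exact subset_closure
      (foot_sub_smul_mem h.isOpen hx (h.normal.norm_eq_one p hp) hxp ⟨h0, hs.2⟩)

theorem continuousOn_deriv_line (h : IsCauchyData Ω R n u c D Q K)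
    {x v : EuclideanSpace ℝ (Fin N)} {I : Set ℝ}
    (hI : MapsTo (fun s : ℝ => x + s • v) I (closure Ω)) :
    ContinuousOn (fun s : ℝ => D (x + s • v) v) I :=
  (h.continuousOn_deriv.comp (by fun_prop) hI).clm_apply continuousOn_const

/-- If the second normal derivative is close to `k` on the segment from `x` to its foot on the
boundary, then `u` is close to `-c d + k d² / 2` at `x`. -/
theorem abs_add_sub_quadratic_le (h : IsCauchyData Ω R n u c D Q K)
    {x p : EuclideanSpace ℝ (Fin N)} (hx : x ∈ Ω) (hp : p ∈ frontier Ω)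
    (hxp : x = p - Metric.infDist x (frontier Ω) • n p) {k η : ℝ}
    (hη : ∀ s ∈ Ioo 0 (Metric.infDist x (frontier Ω)), |Q (p + s • (-n p)) (-n p) - k| ≤ η) :
    |u x + c * Metric.infDist x (frontier Ω) - k * Metric.infDist x (frontier Ω) ^ 2 / 2| ≤
      η * Metric.infDist x (frontier Ω) ^ 2 := by
  have hmem : ∀ s ∈ Ioo 0 (Metric.infDist x (frontier Ω)), p + s • (-n p) ∈ Ω := fun s hs =>
    foot_sub_smul_mem h.isOpen hx (h.normal.norm_eq_one p hp) hxp ⟨hs.1, hs.2.le⟩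
  have hcl := h.foot_sub_smul_mem_closure hx hp hxp
  have h1 := abs_sub_quadratic_le (f := fun s => u (p + s • (-n p)))
    (f' := fun s => D (p + s • (-n p)) (-n p)) (h.infDist_pos hx)
    (h.continuousOn.comp (by fun_prop) hcl) (h.continuousOn_deriv_line hcl)
    (fun s hs => hasDerivAt_comp_line (h.hasFDerivAt _ (hmem s hs)))
    (fun s hs => h.hasDerivAt_deriv p (-n p) s (hmem s hs)) hη
  have hxt : p + Metric.infDist x (frontier Ω) • (-n p) = x := by
    rw [smul_neg, ← sub_eq_add_neg, ← hxp]
  rw [hxt] at h1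
  simp only [zero_smul, add_zero, h.eq_zero p hp, map_neg, h.deriv_normal p hp] at h1
  simpa using h1

theorem abs_add_le (h : IsCauchyData Ω R n u c D Q K) {x : EuclideanSpace ℝ (Fin N)}
    (hx : x ∈ Ω) : |u x + c * Metric.infDist x (frontier Ω)| ≤
      K * Metric.infDist x (frontier Ω) ^ 2 := by
  obtain ⟨p, hp, hxp⟩ := h.exists_foot hx
  have := h.abs_add_sub_quadratic_le hx hp hxp (k := 0) (η := K) fun s hs => by
    have := h.abs_hess_le _ (h.foot_sub_smul_mem_closure hx hp hxp ⟨hs.1.le, hs.2.le⟩) (-n p)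
    rw [norm_neg, h.normal.norm_eq_one p hp] at this
    simpa using this
  simpa using this

/-- Near the boundary the quotient `(u + c d) / d²` is uniformly continuous. -/
theorem exists_abs_quotient_sub_le (h : IsCauchyData Ω R n u c D Q K) {η : ℝ} (hη : 0 < η) :
    ∃ r > 0, ∀ x ∈ Ω, ∀ z ∈ Ω, Metric.infDist x (frontier Ω) < r →
      Metric.infDist z (frontier Ω) < r → dist x z < r →
      |(u x + c * Metric.infDist x (frontier Ω)) / Metric.infDist x (frontier Ω) ^ 2 -
        (u z + c * Metric.infDist z (frontier Ω)) / Metric.infDist z (frontier Ω) ^ 2| ≤ η := by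
  have hcomp : IsCompact (closure Ω ×ˢ Metric.closedBall (0 : EuclideanSpace ℝ (Fin N)) 1) :=
    (isCompact_closure_of_isBounded h.isBounded).prod (isCompact_closedBall _ _)
  obtain ⟨δ, hδ, hQ⟩ := Metric.uniformContinuousOn_iff.mp
    (hcomp.uniformContinuousOn_of_continuous
      (h.continuousOn_hess.mono (prod_mono_right (subset_univ _)))) (η / 2) (by positivity)
  obtain ⟨δ', hδ', hn⟩ := Metric.uniformContinuousOn_iff.mp
    ((isCompact_frontier_of_isBounded h.isBounded).uniformContinuousOn_of_continuous
      h.normal.continuousOn) δ hδ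
  refine ⟨min δ δ' / 4, by positivity, fun x hx z hz hxr hzr hxz => ?_⟩
  obtain ⟨p, hp, hxp⟩ := h.exists_foot hx
  obtain ⟨q, hq, hzq⟩ := h.exists_foot hz
  have hm1 : min δ δ' ≤ δ := min_le_left _ _
  have hm2 : min δ δ' ≤ δ' := min_le_right _ _
  have hdx := h.infDist_pos hx
  have hdz := h.infDist_pos hz
  have hxp' : dist x p = Metric.infDist x (frontier Ω) := by
    nth_rw 1 [hxp]
    rw [dist_eq_norm, sub_sub_cancel_left, norm_neg, h.normal.norm_smul_normal hp hdx.le]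
  have hzq' : dist z q = Metric.infDist z (frontier Ω) := by
    nth_rw 1 [hzq]
    rw [dist_eq_norm, sub_sub_cancel_left, norm_neg, h.normal.norm_smul_normal hq hdz.le]
  have hpq : dist p q < 3 * (min δ δ' / 4) := by
    have h1 := dist_triangle4 p x z q
    rw [dist_comm p x] at h1
    linarith
  have hnpq : dist (n p) (n q) < δ := hn p hp q hq (by linarith)
  have hball : ∀ r ∈ frontier Ω, -n r ∈ Metric.closedBall (0 : EuclideanSpace ℝ (Fin N)) 1 :=
    fun r hr => by rw [mem_closedBall_zero_iff, norm_neg, h.normal.norm_eq_one r hr]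
  -- Both values are compared with half the second normal derivative at the foot of `z`.
  have key : ∀ y ∈ Ω, ∀ r ∈ frontier Ω, y = r - Metric.infDist y (frontier Ω) • n r →
      Metric.infDist y (frontier Ω) < min δ δ' / 4 → dist r q < 3 * (min δ δ' / 4) →
      dist (n r) (n q) < δ →
      |(u y + c * Metric.infDist y (frontier Ω)) / Metric.infDist y (frontier Ω) ^ 2 -
        Q q (-n q) / 2| ≤ η / 2 := by
    intro y hy r hr hyr hyd hrq hnr
    have hdy := h.infDist_pos hy
    have h1 := h.abs_add_sub_quadratic_le hy hr hyr (k := Q q (-n q)) (η := η / 2) fun s hs => by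
      have hcl := h.foot_sub_smul_mem_closure hy hr hyr ⟨hs.1.le, hs.2.le⟩
      have h2 := hQ (r + s • (-n r), -n r)
        ⟨hcl, hball r hr⟩ (q, -n q) ⟨frontier_subset_closure hq, hball q hq⟩ ?_
      · rw [Real.dist_eq] at h2
        exact h2.le
      · rw [Prod.dist_eq, max_lt_iff]
        refine ⟨?_, by simpa using hnr⟩
        have h3 := dist_triangle (r + s • (-n r)) r q
        have h4 : dist (r + s • (-n r)) r = s := by
          rw [dist_eq_norm, add_sub_cancel_left, smul_neg, norm_neg,
            h.normal.norm_smul_normal hr hs.1.le]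
        simp only
        linarith [hs.2]
    have hd2 : 0 < Metric.infDist y (frontier Ω) ^ 2 := by positivity
    have e : (u y + c * Metric.infDist y (frontier Ω)) / Metric.infDist y (frontier Ω) ^ 2 -
        Q q (-n q) / 2 = (u y + c * Metric.infDist y (frontier Ω) -
          Q q (-n q) * Metric.infDist y (frontier Ω) ^ 2 / 2) /
            Metric.infDist y (frontier Ω) ^ 2 := by field_simp
    rw [e, abs_div, abs_of_pos hd2, div_le_iff₀ hd2]
    exact h1
  have hx1 := abs_le.mp (key x hx p hp hxp hxr hpq hnpq)
  have hz1 := abs_le.mp (key z hz q hq hzq hzr (by rw [dist_self]; positivity) (by rwa [dist_self]))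
  rw [abs_le]
  constructor <;> linarith [hx1.1, hx1.2, hz1.1, hz1.2]

theorem abs_taylor_le (h : IsCauchyData Ω R n u c D Q K) {z e : EuclideanSpace ℝ (Fin N)}
    (hz : z ∈ Ω) (he : ‖e‖ < Metric.infDist z (frontier Ω)) :
    |u (z + e) - u z - D z e| ≤ K * ‖e‖ ^ 2 := by
  have hmem : ∀ s ∈ Icc (0 : ℝ) 1, z + s • e ∈ Ω := fun s hs => by
    apply ball_infDist_frontier_subset h.isOpen hz
    rw [Metric.mem_ball, dist_eq_norm, add_sub_cancel_left, norm_smul, Real.norm_of_nonneg hs.1]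
    exact (mul_le_of_le_one_left (norm_nonneg _) hs.2).trans_lt he
  have hcl : MapsTo (fun s : ℝ => z + s • e) (Icc 0 1) (closure Ω) :=
    fun s hs => subset_closure (hmem s hs)
  have h1 := abs_sub_quadratic_le (f := fun s => u (z + s • e)) (h := 0) (η := K * ‖e‖ ^ 2)
    (f' := fun s => D (z + s • e) e) one_pos
    (h.continuousOn.comp (by fun_prop) hcl) (h.continuousOn_deriv_line hcl)
    (fun s hs => hasDerivAt_comp_line (h.hasFDerivAt _ (hmem s ⟨hs.1.le, hs.2.le⟩)))
    (fun s hs => h.hasDerivAt_deriv z e s (hmem s ⟨hs.1.le, hs.2.le⟩))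
    (fun s hs => by simpa using h.abs_hess_le _ (hcl ⟨hs.1.le, hs.2.le⟩) e)
  simpa using h1

theorem abs_deriv_normal_sub_le (h : IsCauchyData Ω R n u c D Q K)
    {x p : EuclideanSpace ℝ (Fin N)} (hx : x ∈ Ω) (hp : p ∈ frontier Ω)
    (hxp : x = p - Metric.infDist x (frontier Ω) • n p) :
    |D x (n p) - c| ≤ K * Metric.infDist x (frontier Ω) := by
  have hmem : ∀ s ∈ Ioo 0 (Metric.infDist x (frontier Ω)), p + s • (-n p) ∈ Ω := fun s hs =>
    foot_sub_smul_mem h.isOpen hx (h.normal.norm_eq_one p hp) hxp ⟨hs.1, hs.2.le⟩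
  have hcl := h.foot_sub_smul_mem_closure hx hp hxp
  have hd := h.infDist_pos hx
  obtain ⟨s, hs, hs1⟩ := exists_hasDerivAt_eq_slope (fun s : ℝ => D (p + s • (-n p)) (-n p)) _ hd
    (h.continuousOn_deriv_line hcl) (fun s hs => h.hasDerivAt_deriv p (-n p) s (hmem s hs))
  have hxt : p + Metric.infDist x (frontier Ω) • (-n p) = x := by
    rw [smul_neg, ← sub_eq_add_neg, ← hxp]
  rw [hxt, sub_zero, eq_div_iff hd.ne', zero_smul, add_zero, map_neg, map_neg,
    h.deriv_normal p hp] at hs1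
  have h1 := h.abs_hess_le _ (hcl ⟨hs.1.le, hs.2.le⟩) (-n p)
  rw [norm_neg, h.normal.norm_eq_one p hp, one_pow, mul_one] at h1
  rw [← abs_neg, neg_sub', sub_neg_eq_add, ← sub_neg_eq_add, ← hs1, abs_mul, abs_of_pos hd]
  exact mul_le_mul_of_nonneg_right h1 hd.le

end IsCauchyData

end SecondOrder

/-! ### The tangential gradient and differences on parallel surfaces -/

section Tangential

variable {N : ℕ} {Ω : Set (EuclideanSpace ℝ (Fin N))} {u : EuclideanSpace ℝ (Fin N) → ℝ}

namespace IsCauchyData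

variable {R c K : ℝ} {n : EuclideanSpace ℝ (Fin N) → EuclideanSpace ℝ (Fin N)}
  {D : EuclideanSpace ℝ (Fin N) → EuclideanSpace ℝ (Fin N) →L[ℝ] ℝ}
  {Q : EuclideanSpace ℝ (Fin N) → EuclideanSpace ℝ (Fin N) → ℝ}

/-- Moving tangentially by `σ d(z)` decreases the distance to the boundary by at most
`σ² d(z)² / R`, thanks to the interior touching ball, and increases its square by at most
`σ² d(z)²`. -/
theorem infDist_add_tangent_bounds (h : IsCauchyData Ω R n u c D Q K)
    {p v : EuclideanSpace ℝ (Fin N)} (hp : p ∈ frontier Ω) {t σ : ℝ} (ht : 0 < t)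
    (htR : t ≤ R / 2) (hσ : 0 ≤ σ) (hv : ‖v‖ = 1) (hnv : inner ℝ (n p) v = 0) :
    t - σ ^ 2 * t ^ 2 / R ≤ Metric.infDist (p - t • n p + (σ * t) • v) (frontier Ω) ∧
      Metric.infDist (p - t • n p + (σ * t) • v) (frontier Ω) ^ 2 ≤ t ^ 2 + σ ^ 2 * t ^ 2 := by
  have hR := h.normal.pos
  have hσt : 0 ≤ σ * t := mul_nonneg hσ ht.le
  have hpyth : ∀ s : ℝ, ‖(σ * t) • v + s • n p‖ ^ 2 = σ ^ 2 * t ^ 2 + s ^ 2 := fun s => by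
    rw [norm_add_sq_real, inner_smul_left, inner_smul_right, real_inner_comm, hnv, norm_smul,
      norm_smul, hv, h.normal.norm_eq_one p hp, mul_one, mul_one, Real.norm_eq_abs,
      Real.norm_eq_abs, sq_abs, sq_abs]
    simp
    ring
  constructor
  · have h1 := sub_dist_le_infDist_frontier h.isOpen h.nonempty (h.normal.ball_subset p hp)
      (x := p - t • n p + (σ * t) • v)
    have e : p - t • n p + (σ * t) • v - (p - R • n p) = (σ * t) • v + (R - t) • n p := by module
    rw [dist_eq_norm, e] at h1
    have h2 : ‖(σ * t) • v + (R - t) • n p‖ ≤ R - t + σ ^ 2 * t ^ 2 / R := by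
      have h0 : 0 ≤ σ ^ 2 * t ^ 2 / R := by positivity
      rw [← pow_le_pow_iff_left₀ (norm_nonneg _) (by linarith) two_ne_zero, hpyth]
      have h3 : R * (σ ^ 2 * t ^ 2 / R) = σ ^ 2 * t ^ 2 := mul_div_cancel₀ _ hR.ne'
      nlinarith [mul_nonneg h0 (by linarith : 0 ≤ R / 2 - t), sq_nonneg (σ ^ 2 * t ^ 2 / R)]
    linarith
  · have h1 := Metric.infDist_le_dist_of_mem (x := p - t • n p + (σ * t) • v) hp
    have e : p - t • n p + (σ * t) • v - p = (σ * t) • v + (-t) • n p := by module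
    rw [dist_eq_norm, e] at h1
    have h2 := pow_le_pow_left₀ Metric.infDist_nonneg h1 2
    rw [hpyth] at h2
    linarith

end IsCauchyData

/-- The arithmetic behind the tangential gradient bound: if `a = -c d + H d²` and
`b = -c t + H' t²` with `|H| ≤ K` and `|H - H'| ≤ η`, while `d` is close to `t` to second order in
`σ`, then `a` cannot lie far below `b`. -/
theorem neg_le_sub_of_quotient_close {a b c d t K R σ η : ℝ} (hc : c ≤ 0) (hR : 0 < R)
    (ht : 0 < t) (htR : t ≤ R / 2) (hd : 0 < d) (hσ : 0 ≤ σ) (hσ1 : σ ≤ 1 / 2) (hK : 0 ≤ K)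
    (hlow : t - σ ^ 2 * t ^ 2 / R ≤ d) (hupp : d ^ 2 ≤ t ^ 2 + σ ^ 2 * t ^ 2)
    (ha : |a + c * d| ≤ K * d ^ 2)
    (hab : |(a + c * d) / d ^ 2 - (b + c * t) / t ^ 2| ≤ η) :
    -((-c / R + K) * (σ ^ 2 * t ^ 2) + η * t ^ 2) ≤ a - b := by
  have hd2 : 0 < d ^ 2 := by positivity
  have ht2 : 0 < t ^ 2 := by positivity
  obtain ⟨H, hH⟩ : ∃ H, H = (a + c * d) / d ^ 2 := ⟨_, rfl⟩
  obtain ⟨H', hH'⟩ : ∃ H, H = (b + c * t) / t ^ 2 := ⟨_, rfl⟩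
  rw [← hH, ← hH'] at hab
  have hHd : a = -c * d + H * d ^ 2 := by rw [hH, div_mul_cancel₀ _ hd2.ne']; ring
  have hHt : b = -c * t + H' * t ^ 2 := by rw [hH', div_mul_cancel₀ _ ht2.ne']; ring
  have hHK : |H| ≤ K := by rwa [hH, abs_div, abs_of_pos hd2, div_le_iff₀ hd2]
  have hσ2 : σ ^ 2 ≤ 1 := pow_le_one₀ hσ (by linarith)
  have hsq : |d ^ 2 - t ^ 2| ≤ σ ^ 2 * t ^ 2 := by
    rw [abs_le]
    refine ⟨?_, by linarith⟩
    have h1 : σ ^ 2 * t ^ 2 / R ≤ σ ^ 2 * t / 2 := by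
      rw [div_le_iff₀ hR]
      have := mul_nonneg (mul_nonneg (sq_nonneg σ) ht.le) (by linarith : 0 ≤ R / 2 - t)
      linarith
    have h0 : σ ^ 2 * t ≤ t := mul_le_of_le_one_left ht.le hσ2
    have h2 : 0 ≤ t - σ ^ 2 * t / 2 := by linarith
    have h3 : (t - σ ^ 2 * t / 2) ^ 2 ≤ d ^ 2 := pow_le_pow_left₀ h2 (by linarith) 2
    linarith [sq_nonneg (σ ^ 2 * t / 2)]
  have h1 : -(-c / R * (σ ^ 2 * t ^ 2)) ≤ -c * (d - t) := by
    have : -c * (-(σ ^ 2 * t ^ 2 / R)) ≤ -c * (d - t) :=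
      mul_le_mul_of_nonneg_left (by linarith) (by linarith)
    calc -(-c / R * (σ ^ 2 * t ^ 2)) = -c * (-(σ ^ 2 * t ^ 2 / R)) := by ring
      _ ≤ _ := this
  have h2 : -(K * (σ ^ 2 * t ^ 2)) ≤ H * (d ^ 2 - t ^ 2) := by
    refine (abs_le.mp ?_).1
    rw [abs_mul]
    exact mul_le_mul hHK hsq (abs_nonneg _) hK
  have h3 : -(η * t ^ 2) ≤ (H - H') * t ^ 2 := by
    have := mul_le_mul_of_nonneg_right (abs_le.mp hab).1 ht2.le
    linarith
  have e1 : a - b = -c * (d - t) + H * (d ^ 2 - t ^ 2) + (H - H') * t ^ 2 := by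
    rw [hHd, hHt]; ring
  linarith

namespace IsCauchyData

/-- The tangential gradient of `u` on a parallel surface is `o(d)`, one-sided version. Since
`c ≤ 0`, the expansion `u = -c d + (u + c d) / d² · d²` and the lower bound for `d` at the point
`z + σ d(z) v` bound `u` there from below; with Taylor's formula at `z` this bounds the
derivative in the direction `v`. -/
theorem exists_neg_le_deriv_tangent (h : IsCauchyData Ω R n u c D Q K) (hc : c ≤ 0) {ε : ℝ}
    (hε : 0 < ε) : ∃ δ > 0, ∀ z ∈ Ω, Metric.infDist z (frontier Ω) < δ → ∀ p ∈ frontier Ω,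
      z = p - Metric.infDist z (frontier Ω) • n p → ∀ v, ‖v‖ = 1 → inner ℝ (n p) v = 0 →
        -(ε * Metric.infDist z (frontier Ω)) ≤ D z v := by
  have hR := h.normal.pos
  have hK := h.pos
  set A := -c / R + 2 * K with hA
  have hcR : 0 ≤ -c / R := div_nonneg (by linarith) hR.le
  have hApos : 0 < A := by positivity
  -- The error `A σ + η / σ` is at most `ε` for `σ ≤ ε / (2 A)` and `η = σ ε / 2`.
  set σ := min (1 / 2) (ε / (2 * A)) with hσdef
  have hσ : 0 < σ := by positivity
  have hσ1 : σ ≤ 1 / 2 := min_le_left _ _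
  have hσ2 : A * σ ≤ ε / 2 := by
    have : σ ≤ ε / (2 * A) := min_le_right _ _
    rw [le_div_iff₀ (by positivity)] at this
    linarith
  obtain ⟨r, hr, hquot⟩ := h.exists_abs_quotient_sub_le (η := σ * ε / 2) (by positivity)
  refine ⟨min (r / 2) (R / 2), by positivity, fun z hz hzδ p hp hzp v hv hnv => ?_⟩
  have ht := h.infDist_pos hz
  have hball := ball_infDist_frontier_subset h.isOpen hz
  have hlip := Metric.infDist_le_infDist_add_dist (s := frontier Ω)
    (x := z + (σ * Metric.infDist z (frontier Ω)) • v) (y := z)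
  have hb := h.infDist_add_tangent_bounds hp ht
    (hzδ.le.trans (min_le_right _ _)) hσ.le hv hnv
  rw [← hzp] at hb
  set t := Metric.infDist z (frontier Ω) with htdef
  have htr : t < r / 2 := hzδ.trans_le (min_le_left _ _)
  have htR : t ≤ R / 2 := hzδ.le.trans (min_le_right _ _)
  have hσt : 0 < σ * t := mul_pos hσ ht
  have hnorm : ‖(σ * t) • v‖ = σ * t := by
    rw [norm_smul, hv, mul_one, Real.norm_of_nonneg hσt.le]
  have hdist : dist (z + (σ * t) • v) z = σ * t := by
    rw [dist_eq_norm, add_sub_cancel_left, hnorm]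
  have hσt2 : σ * t ≤ t / 2 := by nlinarith
  have hx : z + (σ * t) • v ∈ Ω := hball (by rw [Metric.mem_ball, hdist]; linarith)
  have htay := h.abs_taylor_le hz (e := (σ * t) • v) (by rw [hnorm]; linarith)
  rw [hnorm, map_smul, smul_eq_mul] at htay
  rw [hdist] at hlip
  have hdx := h.infDist_pos hx
  have hq := hquot _ hx z hz (by linarith) (by linarith) (by rw [hdist]; linarith)
  have hux := h.abs_add_le hx
  rw [← htdef] at hq
  set x := z + (σ * t) • v with hxdef
  set d := Metric.infDist x (frontier Ω) with hddef
  have hsub := neg_le_sub_of_quotient_close hc hR ht htR hdx hσ.le hσ1 hK.le hb.1 hb.2 hux hq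
  have h4 : A * σ * (σ * t ^ 2) ≤ ε / 2 * (σ * t ^ 2) :=
    mul_le_mul_of_nonneg_right hσ2 (by positivity)
  have h5 : (-c / R + K) * (σ ^ 2 * t ^ 2) + K * (σ * t) ^ 2 = A * σ * (σ * t ^ 2) := by
    rw [hA]; ring
  have h6 := (abs_le.mp htay).2
  have h7 : σ * t * (-(ε * t)) ≤ σ * t * D z v := by
    have e3 : σ * t * (-(ε * t)) = -(ε / 2 * (σ * t ^ 2) + σ * ε / 2 * t ^ 2) := by ring
    linarith
  exact le_of_mul_le_mul_left h7 hσt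

theorem exists_abs_deriv_tangent_le (h : IsCauchyData Ω R n u c D Q K) (hc : c ≤ 0) {ε : ℝ}
    (hε : 0 < ε) : ∃ δ > 0, ∀ z ∈ Ω, Metric.infDist z (frontier Ω) < δ → ∀ p ∈ frontier Ω,
      z = p - Metric.infDist z (frontier Ω) • n p → ∀ v, inner ℝ (n p) v = 0 →
        |D z v| ≤ ε * Metric.infDist z (frontier Ω) * ‖v‖ := by
  obtain ⟨δ, hδ, H⟩ := h.exists_neg_le_deriv_tangent hc hε
  refine ⟨δ, hδ, fun z hz hzδ p hp hzp v hv => ?_⟩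
  rcases eq_or_ne v 0 with rfl | hv0
  · simp
  have hvpos : 0 < ‖v‖ := norm_pos_iff.mpr hv0
  have h1 := H z hz hzδ p hp hzp (‖v‖⁻¹ • v)
    (by rw [norm_smul, norm_inv, norm_norm, inv_mul_cancel₀ hvpos.ne'])
    (by rw [inner_smul_right, hv, mul_zero])
  have h2 := H z hz hzδ p hp hzp (-(‖v‖⁻¹ • v))
    (by rw [norm_neg, norm_smul, norm_inv, norm_norm, inv_mul_cancel₀ hvpos.ne'])
    (by rw [inner_neg_right, inner_smul_right, hv, mul_zero, neg_zero])
  have e : D z v = ‖v‖ * D z (‖v‖⁻¹ • v) := by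
    rw [map_smul, smul_eq_mul, mul_inv_cancel_left₀ hvpos.ne']
  rw [map_neg] at h2
  rw [e, abs_mul, abs_of_pos hvpos, mul_comm]
  exact mul_le_mul_of_nonneg_right (abs_le.mpr ⟨h1, by linarith⟩) hvpos.le

/-- Differences of `u` on `Γ_t` over distances that are small compared with `t`. The contribution
of the normal gradient `c` has a sign controlled by the interior touching ball alone. -/
theorem exists_sub_le_of_dist_lt (h : IsCauchyData Ω R n u c D Q K) (hc : c ≤ 0) {ε : ℝ}
    (hε : 0 < ε) : ∃ κ > 0, ∃ δ > 0, ∀ t, 0 < t → t < δ → ∀ z ∈ parallelSurface Ω t,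
      ∀ w ∈ parallelSurface Ω t, dist w z < κ * t → u w - u z ≤ ε * t * dist w z := by
  have hR := h.normal.pos
  have hK := h.pos
  obtain ⟨δ, hδ, htan⟩ := h.exists_abs_deriv_tangent_le hc (half_pos hε)
  set A := -c / R + 2 * K with hA
  have hcR : 0 ≤ -c / R := div_nonneg (by linarith) hR.le
  have hApos : 0 < A := by positivity
  set κ := min 1 (ε / (2 * A)) with hκdef
  have hκ : 0 < κ := by positivity
  have hκ1 : κ ≤ 1 := min_le_left _ _
  have hκ2 : A * κ ≤ ε / 2 := by
    have : κ ≤ ε / (2 * A) := min_le_right _ _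
    rw [le_div_iff₀ (by positivity)] at this
    linarith
  refine ⟨κ, hκ, min δ (R / 2), by positivity, fun t ht htδ z hz w hw hzw => ?_⟩
  have htR : t ≤ R / 2 := htδ.le.trans (min_le_right _ _)
  obtain ⟨p, hp, hzp⟩ := h.exists_foot hz.1
  have htan' := htan z hz.1 (by rw [hz.2]; exact htδ.trans_le (min_le_left _ _)) p hp hzp
  have hnor := h.abs_deriv_normal_sub_le hz.1 hp hzp
  rw [hz.2] at hzp htan' hnor
  have hlow := h.normal.neg_le_inner_sub h.isOpen h.nonempty hp hzp htR hw.2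
  have hupp := h.normal.inner_sub_le hp ht hzp hw.2
  rw [dist_eq_norm] at hzw ⊢
  have htay := h.abs_taylor_le hz.1 (e := w - z) (by rw [hz.2]; nlinarith)
  rw [add_sub_cancel] at htay
  set e := w - z with hedef
  set a := inner ℝ (n p) e with hadef
  have hnn : inner ℝ (n p) (n p) = 1 := by
    rw [real_inner_self_eq_norm_sq, h.normal.norm_eq_one p hp, one_pow]
  have hperp : inner ℝ (n p) (e - a • n p) = 0 := by
    rw [inner_sub_right, inner_smul_right, hnn, ← hadef]; ring
  have hsplit : D z e = a * D z (n p) + D z (e - a • n p) := by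
    have : D z e = D z (a • n p + (e - a • n p)) := by rw [add_sub_cancel]
    rw [this, map_add, map_smul, smul_eq_mul]
  have hpart : ‖e - a • n p‖ ≤ ‖e‖ := by
    rw [← pow_le_pow_iff_left₀ (norm_nonneg _) (norm_nonneg _) two_ne_zero, norm_sub_sq_real,
      inner_smul_right, real_inner_comm, ← hadef, norm_smul, h.normal.norm_eq_one p hp, mul_one,
      Real.norm_eq_abs, sq_abs]
    nlinarith [sq_nonneg a]
  have hE := norm_nonneg e
  have hsq : ‖e‖ ^ 2 ≤ κ * t * ‖e‖ := by
    rw [sq]; exact mul_le_mul_of_nonneg_right hzw.le hE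
  have ha1 : -(‖e‖ ^ 2 / R) ≤ a := by
    rw [← neg_div, div_le_iff₀ hR]; linarith
  have ha2 : |a| ≤ κ * ‖e‖ := by
    rw [abs_le]
    constructor
    · have : ‖e‖ ^ 2 / R ≤ κ * ‖e‖ := by
        rw [div_le_iff₀ hR]
        nlinarith [mul_nonneg (mul_nonneg hκ.le hE) (by linarith : 0 ≤ R - t)]
      linarith
    · have h1 : 2 * t * a ≤ κ * t * ‖e‖ := hupp.trans hsq
      have h2 : t * a ≤ t * (κ * ‖e‖) := by nlinarith [mul_nonneg (mul_nonneg hκ.le ht.le) hE]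
      exact le_of_mul_le_mul_left h2 ht
  have h1 : c * a ≤ -c / R * (κ * t * ‖e‖) := by
    have h2 : c * a ≤ c * (-(‖e‖ ^ 2 / R)) := mul_le_mul_of_nonpos_left ha1 hc
    have h3 : c * (-(‖e‖ ^ 2 / R)) = -c / R * ‖e‖ ^ 2 := by ring
    have h4 : -c / R * ‖e‖ ^ 2 ≤ -c / R * (κ * t * ‖e‖) := mul_le_mul_of_nonneg_left hsq hcR
    linarith
  have h2 : (D z (n p) - c) * a ≤ K * (κ * t * ‖e‖) := by
    refine (le_abs_self _).trans ?_
    rw [abs_mul]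
    refine (mul_le_mul hnor ha2 (abs_nonneg _) (by positivity)).trans_eq (by ring)
  have h3 : D z (e - a • n p) ≤ ε / 2 * t * ‖e‖ :=
    ((le_abs_self _).trans (htan' _ hperp)).trans
      (mul_le_mul_of_nonneg_left hpart (by positivity))
  have h4 : K * ‖e‖ ^ 2 ≤ K * (κ * t * ‖e‖) := mul_le_mul_of_nonneg_left hsq hK.le
  have h5 : A * κ * (t * ‖e‖) ≤ ε / 2 * (t * ‖e‖) :=
    mul_le_mul_of_nonneg_right hκ2 (by positivity)
  have h6 : A * κ * (t * ‖e‖) = -c / R * (κ * t * ‖e‖) + 2 * (K * (κ * t * ‖e‖)) := by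
    rw [hA]; ring
  have h7 := (abs_le.mp htay).2
  have h8 : a * D z (n p) = (D z (n p) - c) * a + c * a := by ring
  have h9 : ε * t * ‖e‖ = ε / 2 * (t * ‖e‖) + ε / 2 * t * ‖e‖ := by ring
  linarith

theorem exists_abs_sub_le_of_dist_lt (h : IsCauchyData Ω R n u c D Q K) {ε : ℝ} (hε : 0 < ε) :
    ∃ κ > 0, ∃ δ > 0, ∀ t, 0 < t → t < δ → ∀ z ∈ parallelSurface Ω t,
      ∀ w ∈ parallelSurface Ω t, dist z w < κ * t → |u z - u w| ≤ ε * t * dist z w := by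
  rcases le_total c 0 with hc | hc
  · obtain ⟨κ, hκ, δ, hδ, H⟩ := h.exists_sub_le_of_dist_lt hc hε
    refine ⟨κ, hκ, δ, hδ, fun t ht htδ z hz w hw hzw => ?_⟩
    have h1 := H t ht htδ w hw z hz hzw
    rw [dist_comm] at hzw
    have h2 := H t ht htδ z hz w hw hzw
    rw [dist_comm] at h2
    exact abs_le.mpr ⟨by linarith, h1⟩
  · obtain ⟨κ, hκ, δ, hδ, H⟩ := h.neg.exists_sub_le_of_dist_lt (by linarith) hε
    refine ⟨κ, hκ, δ, hδ, fun t ht htδ z hz w hw hzw => ?_⟩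
    have h1 := H t ht htδ w hw z hz hzw
    rw [dist_comm] at hzw
    have h2 := H t ht htδ z hz w hw hzw
    rw [dist_comm] at h2
    exact abs_le.mpr ⟨by linarith, by linarith⟩

/-- On `Γ_t` the function `u` is Lipschitz with a constant that is `o(t)`. Over distances below
`κ t` this is the bound of the tangential gradient; beyond, `u = -c t + t² H` on `Γ_t` with a
bounded function `H` that is uniformly continuous near the boundary. -/
theorem exists_abs_sub_le (h : IsCauchyData Ω R n u c D Q K) {ε : ℝ} (hε : 0 < ε) :
    ∃ δ > 0, ∀ t, 0 < t → t < δ → ∀ z ∈ parallelSurface Ω t, ∀ w ∈ parallelSurface Ω t,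
      |u z - u w| ≤ ε * t * dist z w := by
  have hK := h.pos
  obtain ⟨κ, hκ, δ, hδ, hnear⟩ := h.exists_abs_sub_le_of_dist_lt hε
  obtain ⟨r, hr, hquot⟩ := h.exists_abs_quotient_sub_le (η := ε * κ) (by positivity)
  refine ⟨min (min δ r) (ε * r / (2 * K)), by positivity, fun t ht htm z hz w hw => ?_⟩
  have ht1 : t < δ := htm.trans_le ((min_le_left _ _).trans (min_le_left _ _))
  have ht2 : t < r := htm.trans_le ((min_le_left _ _).trans (min_le_right _ _))
  have ht3 : t * (2 * K) < ε * r := by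
    rw [← lt_div_iff₀ (by positivity)]
    exact htm.trans_le (min_le_right _ _)
  rcases lt_or_ge (dist z w) (κ * t) with hd | hd
  · exact hnear t ht ht1 z hz w hw hd
  rcases lt_or_ge (dist z w) r with hd' | hd'
  · have h1 := hquot z hz.1 w hw.1 (by rwa [hz.2]) (by rwa [hw.2]) hd'
    rw [hz.2, hw.2, ← sub_div, abs_div, abs_of_pos (by positivity : (0 : ℝ) < t ^ 2),
      div_le_iff₀ (by positivity), add_sub_add_right_eq_sub] at h1
    calc |u z - u w| ≤ ε * κ * t ^ 2 := h1
      _ = ε * t * (κ * t) := by ring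
      _ ≤ ε * t * dist z w := mul_le_mul_of_nonneg_left hd (by positivity)
  · have h1 := abs_le.mp (h.abs_add_le hz.1)
    have h2 := abs_le.mp (h.abs_add_le hw.1)
    rw [hz.2] at h1
    rw [hw.2] at h2
    calc |u z - u w| ≤ 2 * K * t ^ 2 :=
          abs_le.mpr ⟨by linarith [h1.1, h2.2], by linarith [h1.2, h2.1]⟩
      _ = t * (t * (2 * K)) := by ring
      _ ≤ t * (ε * r) := mul_le_mul_of_nonneg_left ht3.le ht.le
      _ = ε * t * r := by ring
      _ ≤ ε * t * dist z w := mul_le_mul_of_nonneg_left hd' (by positivity)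

end IsCauchyData

end Tangential

/-! ### Oscillation and seminorms -/

section Seminorms

variable {N : ℕ} {u : EuclideanSpace ℝ (Fin N) → ℝ} {Γ : Set (EuclideanSpace ℝ (Fin N))}

theorem abs_oscOn_le {a η : ℝ} (hΓ : Γ.Nonempty) (h : ∀ x ∈ Γ, |u x - a| ≤ η) :
    |oscOn u Γ| ≤ 2 * η := by
  have hlow : ∀ y ∈ u '' Γ, a - η ≤ y := by
    rintro _ ⟨x, hx, rfl⟩
    linarith [(abs_le.mp (h x hx)).1]
  have hupp : ∀ y ∈ u '' Γ, y ≤ a + η := by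
    rintro _ ⟨x, hx, rfl⟩
    linarith [(abs_le.mp (h x hx)).2]
  have hne : (u '' Γ).Nonempty := hΓ.image u
  have h1 : sSup (u '' Γ) ≤ a + η := csSup_le hne hupp
  have h2 : a - η ≤ sInf (u '' Γ) := le_csInf hne hlow
  have h3 : sInf (u '' Γ) ≤ sSup (u '' Γ) := csInf_le_csSup hne ⟨_, hlow⟩ ⟨_, hupp⟩
  rw [oscOn, abs_of_nonneg (by linarith)]
  linarith

theorem chordSeminorm_le {M : ℝ} (hM : 0 ≤ M)
    (h : ∀ z ∈ Γ, ∀ w ∈ Γ, |u z - u w| ≤ M * dist z w) :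
    chordSeminorm u Γ ≤ ENNReal.ofReal M := by
  refine iSup₂_le fun z hz => iSup₂_le fun w hw => iSup_le fun _ => ENNReal.div_le_of_le_mul ?_
  rw [edist_dist, ← ENNReal.ofReal_mul hM]
  exact ENNReal.ofReal_le_ofReal (h z hz w hw)

theorem edist_le_intrinsicEDist (z w : EuclideanSpace ℝ (Fin N)) :
    edist z w ≤ intrinsicEDist Γ z w := by
  refine le_iInf₂ fun γ _ => le_iInf fun _ => le_iInf₂ fun h0 h1 => ?_
  rw [← h0, ← h1]
  exact eVariationOn.edist_le γ (left_mem_Icc.mpr zero_le_one) (right_mem_Icc.mpr zero_le_one)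

theorem intrinsicSeminorm_le_chordSeminorm : intrinsicSeminorm u Γ ≤ chordSeminorm u Γ :=
  iSup₂_mono fun z _ => iSup₂_mono fun w _ => iSup_mono fun _ =>
    ENNReal.div_le_div_left (edist_le_intrinsicEDist z w) _

theorem IsClosedArcLengthParam.mem {L : ℝ} {z : ℝ → EuclideanSpace ℝ (Fin N)}
    (h : IsClosedArcLengthParam Γ L z) {s : ℝ} (hs : s ∈ Icc 0 L) : z s ∈ Γ := by
  rw [← h.image_eq]
  rcases hs.2.lt_or_eq with h1 | h1
  · exact ⟨s, ⟨hs.1, h1⟩, rfl⟩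
  · exact ⟨0, ⟨le_rfl, h.length_pos⟩, by rw [h1]; simpa using (h.periodic 0).symm⟩

theorem IsClosedArcLengthParam.dist_le {L : ℝ} {z : ℝ → EuclideanSpace ℝ (Fin N)}
    (h : IsClosedArcLengthParam Γ L z) {s r : ℝ} (hs : s ∈ Icc 0 L) (hr : r ∈ Icc 0 L) :
    dist (z s) (z r) ≤ min |s - r| (L - |s - r|) := by
  have hlip : LipschitzWith 1 z :=
    lipschitzWith_of_nnnorm_deriv_le (h.contDiff.differentiable one_ne_zero) fun s => by
      rw [← NNReal.coe_le_coe, coe_nnnorm, h.norm_deriv, NNReal.coe_one]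
  have key : ∀ a b, dist (z a) (z b) ≤ |a - b| := fun a b => by
    simpa [Real.dist_eq] using hlip.dist_le_mul a b
  refine le_min (key s r) ?_
  rcases le_total s r with hsr | hsr
  · have h1 := key (s + L) r
    rw [h.periodic s, abs_of_nonneg (by linarith [hs.1, hr.2])] at h1
    rw [abs_of_nonpos (by linarith)]
    linarith
  · have h1 := key s (r + L)
    rw [h.periodic r, abs_of_nonpos (by linarith [hr.1, hs.2])] at h1
    rw [abs_of_nonneg (by linarith)]
    linarith

theorem IsClosedArcLengthParam.arcSeminorm_le {L M : ℝ} {z : ℝ → EuclideanSpace ℝ (Fin N)}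
    (hz : IsClosedArcLengthParam Γ L z) (hM : 0 ≤ M)
    (h : ∀ z ∈ Γ, ∀ w ∈ Γ, |u z - u w| ≤ M * dist z w) :
    arcSeminorm u L z ≤ ENNReal.ofReal M := by
  refine iSup₂_le fun s hs => iSup₂_le fun r hr => iSup_le fun _ => ENNReal.div_le_of_le_mul ?_
  rw [← ENNReal.ofReal_mul hM]
  exact ENNReal.ofReal_le_ofReal ((h _ (hz.mem hs) _ (hz.mem hr)).trans
    (mul_le_mul_of_nonneg_left (hz.dist_le hs hr) hM))

theorem isLittleO_toReal_of_le {S : ℝ → ℝ≥0∞}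
    (h : ∀ ε : ℝ, 0 < ε → ∀ᶠ t in 𝓝[>] (0 : ℝ), S t ≤ ENNReal.ofReal (ε * t)) :
    (∀ᶠ t in 𝓝[>] (0 : ℝ), S t ≠ ∞) ∧
      (fun t : ℝ => (S t).toReal) =o[𝓝[>] 0] (fun t : ℝ => t) := by
  refine ⟨(h 1 one_pos).mono fun t ht => (ht.trans_lt ENNReal.ofReal_lt_top).ne, ?_⟩
  refine isLittleO_iff.mpr fun ε hε => ?_
  filter_upwards [h ε hε, self_mem_nhdsWithin] with t ht ht0
  have ht0 : 0 < t := ht0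
  rw [Real.norm_of_nonneg ENNReal.toReal_nonneg, Real.norm_of_nonneg ht0.le]
  exact ENNReal.toReal_le_of_le_ofReal (by positivity) ht

end Seminorms

theorem mainTheorem3 (N : ℕ) (Ω : Set (EuclideanSpace ℝ (Fin N)))
    (hΩopen : IsOpen Ω) (hΩconn : IsConnected Ω) (hΩbdd : Bornology.IsBounded Ω)
    (hΩ : HasC2Boundary Ω)
    (u : EuclideanSpace ℝ (Fin N) → ℝ)
    (hu1 : IsCkUpToBoundary 1 Ω u) (hu2 : ContDiffOn ℝ 2 u Ω)
    (hu : SolvesTorsionProblem Ω u)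
    (c : ℝ) (hc : ∀ p ν, IsOuterUnitNormal Ω p ν → HasNormalDerivAt u p ν c) :
    ((∀ᶠ t in 𝓝[>] (0 : ℝ), ∃ z ∈ parallelSurface Ω t, ∃ w ∈ parallelSurface Ω t,
        IsMaxOn u (parallelSurface Ω t) z ∧ IsMinOn u (parallelSurface Ω t) w) ∧
      (fun t : ℝ => oscOn u (parallelSurface Ω t)) =o[𝓝[>] 0] (fun t : ℝ => t)) ∧
    (IsCkUpToBoundary 2 Ω u →
      ((∀ᶠ t in 𝓝[>] (0 : ℝ), chordSeminorm u (parallelSurface Ω t) ≠ ∞) ∧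
        (fun t : ℝ => (chordSeminorm u (parallelSurface Ω t)).toReal)
          =o[𝓝[>] 0] (fun t : ℝ => t)) ∧
      ((∀ᶠ t in 𝓝[>] (0 : ℝ), intrinsicSeminorm u (parallelSurface Ω t) ≠ ∞) ∧
        (fun t : ℝ => (intrinsicSeminorm u (parallelSurface Ω t)).toReal)
          =o[𝓝[>] 0] (fun t : ℝ => t)) ∧
      (∀ ε : ℝ, 0 < ε → ∀ᶠ t in 𝓝[>] (0 : ℝ), ∀ Γ ⊆ parallelSurface Ω t,
        ∀ (L : ℝ) (z : ℝ → EuclideanSpace ℝ (Fin N)), IsClosedArcLengthParam Γ L z →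
          arcSeminorm u L z ≤ ENNReal.ofReal (ε * t))) := by
  -- In dimension zero the Laplacian vanishes, so there is no solution.
  have hN : N ≠ 0 := by
    rintro rfl
    obtain ⟨x, hx⟩ := hΩconn.nonempty
    have h1 := hu.1 x hx
    rw [InnerProductSpace.laplacian_eq_iteratedFDeriv_orthonormalBasis u
      (EuclideanSpace.basisFun (Fin 0) ℝ)] at h1
    simp at h1
  have hne := nonempty_frontier_of_isBounded hN hΩbdd hΩconn.nonempty
  obtain ⟨R, n, hn⟩ := hΩ.exists_isNormalField hΩopen hΩbdd
  obtain ⟨D, hDc, hD⟩ := hu1.exists_fderiv_extension le_rfl hΩopen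
  have hDn : ∀ p ∈ frontier Ω, D p (n p) = c := fun p hp =>
    hn.extension_apply_normal hu1.1 hDc hD hp (hc p _ (hn.isOuterUnitNormal p hp))
  have hΓne := eventually_parallelSurface_nonempty hΩopen hΩbdd hΩconn.nonempty hne
  refine ⟨⟨?_, ?_⟩, fun hC2 => ?_⟩
  · filter_upwards [hΓne, self_mem_nhdsWithin] with t htne ht
    have hcomp := isCompact_parallelSurface hΩopen hΩbdd ht
    have hcont : ContinuousOn u (parallelSurface Ω t) :=
      hu1.1.mono fun x hx => subset_closure hx.1
    obtain ⟨z, hz, hzmax⟩ := hcomp.exists_isMaxOn htne hcont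
    obtain ⟨w, hw, hwmin⟩ := hcomp.exists_isMinOn htne hcont
    exact ⟨z, hz, w, hw, hzmax, hwmin⟩
  · refine isLittleO_iff.mpr fun ε hε => ?_
    obtain ⟨δ, hδ, hexp⟩ := hn.abs_add_mul_infDist_le hΩopen hΩbdd hne hu1.1 hDc hD hu.2 hDn
      (half_pos hε)
    filter_upwards [hΓne, Ioo_mem_nhdsGT hδ] with t htne ht
    rw [Real.norm_eq_abs, Real.norm_of_nonneg ht.1.le]
    have := abs_oscOn_le (u := u) (a := -(c * t)) (η := ε / 2 * t) htne fun x hx => by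
      have h1 := hexp x hx.1 (by rw [hx.2]; exact ht.2)
      rw [hx.2] at h1
      rwa [sub_neg_eq_add]
    linarith
  · obtain ⟨Q, K, hK, hQc, hQK, hQ⟩ := hC2.exists_quadraticForm_extension hΩbdd
    have hdata : IsCauchyData Ω R n u c D Q K :=
      { isOpen := hΩopen
        isBounded := hΩbdd
        nonempty := hne
        normal := hn
        continuousOn := hu1.1
        continuousOn_deriv := hDc
        hasFDerivAt := hD
        eq_zero := hu.2
        deriv_normal := hDn
        pos := hK
        continuousOn_hess := hQc
        abs_hess_le := hQK
        hasDerivAt_deriv := fun x v s hs => by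
          have h1 : DifferentiableAt ℝ (fderiv ℝ u) (x + s • v) :=
            ((hu2.fderiv_of_isOpen hΩopen (m := 1) (by norm_num)).differentiableOn
              one_ne_zero).differentiableAt (hΩopen.mem_nhds hs)
          have h2 : HasFDerivAt D (fderiv ℝ (fderiv ℝ u) (x + s • v)) (x + s • v) := by
            refine h1.hasFDerivAt.congr_of_eventuallyEq ?_
            filter_upwards [hΩopen.mem_nhds hs] with y hy using (hD y hy).fderiv.symm
          rw [← hQ _ hs]
          exact hasDerivAt_apply_comp_line h2 }
    have key : ∀ ε : ℝ, 0 < ε → ∀ᶠ t in 𝓝[>] (0 : ℝ), 0 ≤ ε * t ∧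
        ∀ z ∈ parallelSurface Ω t, ∀ w ∈ parallelSurface Ω t,
          |u z - u w| ≤ ε * t * dist z w := by
      intro ε hε
      obtain ⟨δ, hδ, hlip⟩ := hdata.exists_abs_sub_le hε
      filter_upwards [Ioo_mem_nhdsGT hδ] with t ht
      exact ⟨mul_nonneg hε.le ht.1.le, hlip t ht.1 ht.2⟩
    refine ⟨isLittleO_toReal_of_le fun ε hε => (key ε hε).mono fun t ht =>
        chordSeminorm_le ht.1 ht.2, isLittleO_toReal_of_le fun ε hε => (key ε hε).mono fun t ht =>
        intrinsicSeminorm_le_chordSeminorm.trans (chordSeminorm_le ht.1 ht.2), ?_⟩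
    intro ε hε
    filter_upwards [key ε hε] with t ht Γ hΓ L z hz
    exact hz.arcSeminorm_le ht.1 fun x hx y hy => ht.2 x (hΓ hx) y (hΓ hy)
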